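/- Let $W=S_n$ act on $V=\mathbb{C}^n$ by permuting coordinates, let $c$ be an indeterminate, and put $S(V)=\mathbb{C}[x_1,\dots,x_n]$, $S_c(V)=\mathbb{C}(c)[x_1,\dots,x_n]$. For $y\in\mathbb{C}^n$ let $$\nabla_y=\partial_y-c\sum_{1\le i<j\le n}\frac{y_i-y_j}{x_i-x_j}(1-s_{ij})$$ be the Dunkl operators on $S_c(V)$, where $s_{ij}$ switches $x_i$ and $x_j$. These operators commute; for $p\in S_c(V)$ let $\nabla_p$ be the operator obtained from $p$ by replacing each $x_i$ with the Dunkl operator in the direction of the $i$-th basis vector, and let $(f,g)_c\in\mathbb{C}(c)$ be the constant term of $\nabla_f(g)$. For $a,a'\in\mathbb{Z}_{\ge0}^n$ write $a'\prec a$ if the last non-zero coordinate of $a-a'$ is positive. A canonical invariant $b_a$ is a homogeneous element of $S_c(V)^{S_n}$ such that for every homogeneous generating set $u_1,\dots,u_n$ of $S(V)^{S_n}$ with $\deg u_i=i$, writing $u^a=u_1^{a_1}\cdots u_n^{a_n}$, 1. $b_a\in\mathbb{C}^\times\cdot u^a+\sum_{a'\prec a}\mathbb{C}(c)\cdot u^{a'}$,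 and 2. $(u^{a'},b_a)_c=0$ whenever $a'\prec a$. For $1\le k\le n$, an elementary canonical invariant of degree $k$ is a canonical invariant $b_a$ where $a$ is the $\prec$-greatest exponent with $\sum_i i\,a_i=k$ (that is, $a$ is the $k$-th unit vector). **Theorem.** Let $2\le k\le n$. Elementary canonical invariants of degree $k$ exist and are unique up to multiplication by a nonzero complex constant; denote by $e_k^{(c)}$ the one of the form $e_k+\sum_{a'}\beta_{a'}(c)\,e_1^{a'_1}\cdots e_{k-1}^{a'_{k-1}}$ with $\beta_{a'}(c)\in\mathbb{C}(c)$, where $e_1,\dots,e_n$ are the elementary symmetric polynomials. Then the coefficients of $e_k^{(c)}$ have no pole at $c=1/n$, and, coefficientwise, $$\lim_{c\to1/n}e_k^{(c)}=e_k\left(x_1-\frac{e_1(x)}{n},\dots,x_n-\frac{e_1(x)}{n}\right).$$ -/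

import Mathlib

namespace DunklSn

open MvPolynomial

/-- `x_i - x_j` divides `f - s_ij f`. -/
theorem sub_dvd_sub_swap {R : Type*} [CommRing R] {n : ℕ} (i j : Fin n)
    (f : MvPolynomial (Fin n) R) :
    (X i - X j : MvPolynomial (Fin n) R) ∣ f - rename (Equiv.swap i j) f := by
  induction f using MvPolynomial.induction_on with
  | C a => simp
  | add p q hp hq =>
    have h := dvd_add hp hq
    rw [map_add]
    convert h using 1
    ring
  | mul_X p m hp =>
    have hX : (X i - X j : MvPolynomial (Fin n) R) ∣ X m - X (Equiv.swap i j m) := by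
      by_cases h1 : m = i
      · subst h1; simp
      · by_cases h2 : m = j
        · subst h2
          rw [Equiv.swap_apply_right, ← neg_sub (X i)]
          exact (dvd_refl _).neg_right
        · rw [Equiv.swap_apply_of_ne_of_ne h1 h2]; simp
    have h := dvd_add (hp.mul_right (X m)) (hX.mul_left (rename (Equiv.swap i j) p))
    rw [map_mul, rename_X]
    convert h using 1
    ring

/-- The polynomial `(f - s_ij f) / (x_i - x_j)` for `i ≠ j` (and `0` for `i = j`, which is
never used). -/
noncomputable def divDiff {R : Type*} [CommRing R] {n : ℕ} (i j : Fin n)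
    (f : MvPolynomial (Fin n) R) : MvPolynomial (Fin n) R :=
  if i = j then 0 else Classical.choose (sub_dvd_sub_swap i j f)

/-- For `i ≠ j`, `divDiff i j f` is the quotient of `f - s_ij f` by `x_i - x_j`. -/
theorem divDiff_spec {R : Type*} [CommRing R] {n : ℕ} {i j : Fin n} (h : i ≠ j)
    (f : MvPolynomial (Fin n) R) :
    (X i - X j) * divDiff i j f = f - rename (Equiv.swap i j) f := by
  rw [divDiff, if_neg h]
  exact (Classical.choose_spec (sub_dvd_sub_swap i j f)).symm

theorem X_sub_X_ne_zero {R : Type*} [CommRing R] [Nontrivial R] {n : ℕ} {i j : Fin n}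
    (h : i ≠ j) : (X i - X j : MvPolynomial (Fin n) R) ≠ 0 :=
  sub_ne_zero.mpr fun h' => h (X_injective h')

/-- `divDiff` as a linear map. -/
noncomputable def divDiffLin {R : Type*} [CommRing R] [IsDomain R] {n : ℕ} (i j : Fin n) :
    MvPolynomial (Fin n) R →ₗ[R] MvPolynomial (Fin n) R where
  toFun := divDiff i j
  map_add' f g := by
    by_cases h : i = j
    · simp [divDiff, h]
    · refine mul_left_cancel₀ (X_sub_X_ne_zero h) ?_
      rw [mul_add, divDiff_spec h, divDiff_spec h, divDiff_spec h, map_add]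
      ring
  map_smul' r f := by
    by_cases h : i = j
    · simp [divDiff, h]
    · refine mul_left_cancel₀ (X_sub_X_ne_zero h) ?_
      rw [RingHom.id_apply, mul_smul_comm, divDiff_spec h, divDiff_spec h, map_smul, smul_sub]

/-- The field `ℂ(c)`. -/
abbrev Kc : Type := RatFunc ℂ

/-- `S(V) = ℂ[x_1, …, x_n]` for `V = ℂⁿ`. -/
abbrev SV (n : ℕ) : Type := MvPolynomial (Fin n) ℂ

/-- `S_c(V) = ℂ(c)[x_1, …, x_n]`. -/
abbrev ScV (n : ℕ) : Type := MvPolynomial (Fin n) Kc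

/-- The inclusion `S(V) ⊆ S_c(V)`. -/
noncomputable def toSc {n : ℕ} (f : SV n) : ScV n := MvPolynomial.map RatFunc.C f

/-- The Dunkl operator
`∇_y = ∂_y - c ∑_{i < j} (y_i - y_j) / (x_i - x_j) (1 - s_ij)` of the symmetric group `S_n`,
with `c` the indeterminate of `ℂ(c)`. -/
noncomputable def dunkl {n : ℕ} (y : Fin n → Kc) : Module.End Kc (ScV n) :=
  (∑ i, y i • ((pderiv i).toLinearMap : ScV n →ₗ[Kc] ScV n)) -
    (RatFunc.X : Kc) • ∑ i, ∑ j, if i < j then (y i - y j) • divDiffLin i j else 0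

/-- The operator `∇_p`: each `x_i` in `p` is replaced by the Dunkl operator in direction of
the `i`-th basis vector (`V` and `V*` are identified by the standard scalar product). The Dunkl
operators commute, so the order of the factors in each monomial (here: increasing in `i`)
is immaterial, and `p ↦ ∇_p` is the algebra homomorphism extending `y ↦ ∇_y`. -/
noncomputable def dunklPoly {n : ℕ} (p : ScV n) : Module.End Kc (ScV n) :=
  ∑ m ∈ p.support,
    p.coeff m • (List.ofFn fun i : Fin n => dunkl (Pi.single i (1 : Kc)) ^ m i).prod

/-- The bilinear form `(f, g)_c = [∇_f g]_0`, the constant term of `∇_f g`. -/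
noncomputable def dunklForm {n : ℕ} (f g : ScV n) : Kc := constantCoeff (dunklPoly f g)

/-- `a' ≺ a` in the inverse lexicographic order: the last non-zero coordinate of `a - a'` is
positive. -/
def InvLexLT {n : ℕ} (a' a : Fin n → ℕ) : Prop :=
  ∃ i, a' i < a i ∧ ∀ j, i < j → a' j = a j

/-- `u_1, …, u_n` are homogeneous generators of `S(V)^{S_n}`, listed by increasing degree; the
degrees are `1, …, n`. -/
structure IsHomogeneousGenerators {n : ℕ} (u : Fin n → SV n) : Prop where
  homogeneous : ∀ i, (u i).IsHomogeneous ((i : ℕ) + 1)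
  generates : Algebra.adjoin ℂ (Set.range u) = symmetricSubalgebra (Fin n) ℂ

/-- The monomial `u^a = u_1^{a_1} ⋯ u_n^{a_n}`, in `S_c(V)`. -/
noncomputable def uPow {n : ℕ} (u : Fin n → SV n) (a : Fin n → ℕ) : ScV n :=
  toSc (∏ i, u i ^ a i)

/-- The `ℂ(c)`-span of the `u^{a'}` with `a' ≺ a`. -/
noncomputable def lowerSpan {n : ℕ} (u : Fin n → SV n) (a : Fin n → ℕ) :
    Submodule Kc (ScV n) :=
  Submodule.span Kc {f | ∃ a', InvLexLT a' a ∧ f = uPow u a'}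

/-- `b` is a canonical `S_n`-invariant `b_a`. -/
structure IsCanonicalInvariant {n : ℕ} (a : Fin n → ℕ) (b : ScV n) : Prop where
  homogeneous : ∃ d, b.IsHomogeneous d
  symmetric : b.IsSymmetric
  leading : ∀ u : Fin n → SV n, IsHomogeneousGenerators u →
    ∃ lam : ℂ, lam ≠ 0 ∧ b - C (RatFunc.C lam) * uPow u a ∈ lowerSpan u a
  orthogonal : ∀ u : Fin n → SV n, IsHomogeneousGenerators u →
    ∀ a', InvLexLT a' a → dunklForm (uPow u a') b = 0

/-- The degree `∑ d_i a_i` of `u^a`, where `d_i = i` for `1 ≤ i ≤ n`. -/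
def weight {n : ℕ} (a : Fin n → ℕ) : ℕ := ∑ i : Fin n, ((i : ℕ) + 1) * a i

/-- `b` is an elementary canonical invariant `e_d^{(c)} = b_a`, where `a` is the `≺`-greatest
exponent with `∑ d_i a_i = d`. -/
def IsElementaryCanonical (n d : ℕ) (b : ScV n) : Prop :=
  ∃ a : Fin n → ℕ, weight a = d ∧
    (∀ a' : Fin n → ℕ, weight a' = d → a' ≠ a → InvLexLT a' a) ∧ IsCanonicalInvariant a b

/-- The elementary symmetric polynomials `e_1, …, e_n`. -/
noncomputable def elemSymm (n : ℕ) : Fin n → SV n := fun i => esymm (Fin n) ℂ ((i : ℕ) + 1)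

/-- `e_k(x_1 - e_1(x)/n, …, x_n - e_1(x)/n)`. -/
noncomputable def centeredEsymm (n k : ℕ) : SV n :=
  aeval (fun i : Fin n => (X i - C ((n : ℂ)⁻¹) * esymm (Fin n) ℂ 1 : SV n)) (esymm (Fin n) ℂ k)

/-- No coefficient of `b` has a pole at `c = c₀`. -/
def NoPoleAt {n : ℕ} (b : ScV n) (c₀ : ℂ) : Prop :=
  ∀ m, (b.coeff m).denom.eval c₀ ≠ 0

/-- `lim_{c → c₀} b = f`, coefficient by coefficient. -/
def HasLimitAt {n : ℕ} (b : ScV n) (c₀ : ℂ) (f : SV n) : Prop :=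
  ∀ m, Filter.Tendsto (fun z : ℂ => RatFunc.eval (RingHom.id ℂ) z (b.coeff m))
    (nhdsWithin c₀ {c₀}ᶜ) (nhds (f.coeff m))

end DunklSn

open MvPolynomial DunklSn

namespace DunklSn

/-! ### Divided differences and commuting Dunkl operators over an arbitrary domain. -/

section General

variable {R : Type*} [CommRing R] {n : ℕ}

/-! Write `ē_k` for the centred polynomial `e_k(x - e_1/n)` and `A` for the algebra generated by
`e_1, …, e_{k-1}`. The invariant sought is `b = e_k + Q` with `Q ∈ A` of degree `k` and `b`
orthogonal to `A`. Since `∑ ∇_i = ∑ ∂_i`, orthogonality makes `b` translation invariant: `∇_{e_1} b`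
is symmetric of degree `k - 1`, orthogonal to all polynomials, hence zero because the form is
nondegenerate for generic `c`. The polynomial `ē_k` is translation invariant too and lies in `e_k +
A`, so the difference `b - ē_k` is a translation invariant element of `A`.

Three facts govern `c = 1/n`. Pairings with a translation invariant polynomial without constant term
are divisible by `1 - nc` (`dvd_dForm`). The operators `∇_f`, for `f` symmetric and homogeneous of
positive degree, kill `ē_k` at `c = 1/n` (`dPoly_centeredEsymm`); with the first fact, the pairings
of `ē_k` with `A` are divisible by `(c - 1/n)^2` (`unif_sq_dvd_dForm_centeredEsymm`). Finally, at `c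
= 1/n` no nonzero homogeneous polynomial of degree at least 2 is killed by all `∇_i`
(`eq_zero_of_singular`), so a translation invariant homogeneous polynomial of positive degree whose
pairings are all divisible by `(c - 1/n)^2` vanishes at `c = 1/n`.

For a translation invariant element of `A` of degree `k` it is enough to test pairings with `A`:
averaging reduces to symmetric polynomials, and `e_k` is replaced by `ē_k`. This is
`map_spec_eq_zero_of_lowVars`, and it is used twice. With zero pairings, infinite descent along
powers of `c - 1/n` shows that the form is nondegenerate on the degree `k` part of `A`, which gives
existence and uniqueness of `b`. Applied to `b - ē_k`, after cancelling common factors `c - 1/n`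
from a denominator, it gives both the absence of a pole and the limit. -/

theorem homogeneous_succ_induction {p : MvPolynomial (Fin n) R → Prop} {d : ℕ}
    (zero : p 0) (add : ∀ f g, p f → p g → p (f + g))
    (mul : ∀ i f, f.IsHomogeneous d → p (X i * f))
    {f : MvPolynomial (Fin n) R} (hf : f.IsHomogeneous (d + 1)) : p f := by
  rw [f.as_sum]
  refine Finset.sum_induction _ p add zero fun m hm => ?_
  have hd : m.degree = d + 1 := by
    by_contra h
    exact (mem_support_iff.mp hm) (hf.coeff_eq_zero h)
  have hm0 : m ≠ 0 := by
    rintro rfl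
    simp at hd
  obtain ⟨i, hi⟩ := Finsupp.ne_iff.mp hm0
  have hle : Finsupp.single i 1 ≤ m := by
    rw [Finsupp.single_le_iff]
    exact Nat.one_le_iff_ne_zero.mpr hi
  have hsplit : monomial m (coeff m f) =
      X i * monomial (m - Finsupp.single i 1) (coeff m f) := by
    rw [X, monomial_mul, one_mul, add_tsub_cancel_of_le hle]
  rw [hsplit]
  refine mul i _ (isHomogeneous_monomial _ ?_)
  have h2 : m = Finsupp.single i 1 + (m - Finsupp.single i 1) :=
    (add_tsub_cancel_of_le hle).symm
  have h3 := congrArg Finsupp.degree h2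
  rw [map_add, Finsupp.degree_single] at h3
  omega

theorem eq_C_of_isHomogeneous_zero {f : MvPolynomial (Fin n) R} (hf : f.IsHomogeneous 0) :
    f = C (constantCoeff f) := by
  have h := totalDegree_eq_zero_iff_eq_C.mp (Nat.le_zero.mp hf.totalDegree_le)
  simpa [constantCoeff_eq] using h

theorem coeff_single_X_mul (i k : Fin n) (f : MvPolynomial (Fin n) R) :
    coeff (Finsupp.single k 1) (X i * f) = if i = k then constantCoeff f else 0 := by
  classical
  rw [coeff_X_mul']
  by_cases h : i = k
  · subst h
    simp [constantCoeff_eq]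
  · rw [if_neg h, if_neg]
    simpa [Finsupp.single_apply] using h

theorem divDiff_self (i : Fin n) (f : MvPolynomial (Fin n) R) : divDiff i i f = 0 := by
  simp [divDiff]

/-- The commutator of a Dunkl operator and a coordinate. -/
noncomputable def dunklComm (c : R) (i k : Fin n) : Module.End R (MvPolynomial (Fin n) R) :=
  if i = k then LinearMap.id - c • ∑ j, if j = i then 0 else
      (rename (Equiv.swap i j)).toLinearMap
  else c • (rename (Equiv.swap i k)).toLinearMap

theorem dunklComm_self_apply (c : R) (i : Fin n) (f : MvPolynomial (Fin n) R) :
    dunklComm c i i f = f - C c * ∑ j, if j = i then 0 else rename (Equiv.swap i j) f := by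
  simp only [dunklComm, if_true, LinearMap.sub_apply, LinearMap.smul_apply, LinearMap.sum_apply,
    smul_eq_C_mul, LinearMap.id_apply]
  congr 2
  refine Finset.sum_congr rfl fun j _ => ?_
  split_ifs <;> rfl

theorem dunklComm_apply_of_ne (c : R) {i k : Fin n} (h : i ≠ k) (f : MvPolynomial (Fin n) R) :
    dunklComm c i k f = C c * rename (Equiv.swap i k) f := by
  simp [dunklComm, h, smul_eq_C_mul]

theorem dunklComm_symm (c : R) (i k : Fin n) :
    dunklComm c i k = dunklComm c k i := by
  by_cases h : i = k
  · rw [h]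
  · refine LinearMap.ext fun f => ?_
    rw [dunklComm_apply_of_ne c h, dunklComm_apply_of_ne c (Ne.symm h), Equiv.swap_comm]

variable [IsDomain R]

theorem divDiff_unique {i j : Fin n} (h : i ≠ j) {f g : MvPolynomial (Fin n) R}
    (hg : (X i - X j) * g = f - rename (Equiv.swap i j) f) : divDiff i j f = g :=
  mul_left_cancel₀ (X_sub_X_ne_zero h) ((divDiff_spec h f).trans hg.symm)

theorem map_divDiff {A S : Type*} [CommRing A] [CommRing S] [IsDomain S] (φ : A →+* S) (i j : Fin n)
    (f : MvPolynomial (Fin n) A) : map φ (divDiff i j f) = divDiff i j (map φ f) := by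
  by_cases h : i = j
  · subst h; simp [divDiff_self]
  · refine (divDiff_unique h ?_).symm
    have := congrArg (map φ) (divDiff_spec h f)
    rw [map_mul, map_sub, map_sub, map_X, map_X, map_rename] at this
    exact this

theorem divDiff_symm (i j : Fin n) (f : MvPolynomial (Fin n) R) :
    divDiff j i f = - divDiff i j f := by
  by_cases h : i = j
  · subst h; simp [divDiff_self]
  · refine divDiff_unique (Ne.symm h) ?_
    rw [Equiv.swap_comm, ← divDiff_spec h f]
    ring

theorem rename_divDiff (σ : Equiv.Perm (Fin n)) (i j : Fin n) (f : MvPolynomial (Fin n) R) :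
    rename σ (divDiff i j f) = divDiff (σ i) (σ j) (rename σ f) := by
  by_cases h : i = j
  · subst h; simp [divDiff_self]
  · refine (divDiff_unique (fun e => h (σ.injective e)) ?_).symm
    have := congrArg (rename σ) (divDiff_spec h f)
    rw [map_mul, map_sub, map_sub, rename_X, rename_X, rename_rename] at this
    rw [this, rename_rename]
    congr 3
    funext x
    simp only [Function.comp]
    rw [Equiv.swap_apply_def, Equiv.swap_apply_def]
    simp only [σ.injective.eq_iff]
    split_ifs <;> rfl

theorem divDiff_mul (i j : Fin n) (f g : MvPolynomial (Fin n) R) :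
    divDiff i j (f * g) = f * divDiff i j g + divDiff i j f * rename (Equiv.swap i j) g := by
  by_cases h : i = j
  · subst h; simp [divDiff_self]
  · refine divDiff_unique h ?_
    rw [map_mul]
    linear_combination f * divDiff_spec h g + rename (Equiv.swap i j) g * divDiff_spec h f

theorem divDiff_X {i j : Fin n} (h : i ≠ j) (k : Fin n) :
    divDiff i j (X k : MvPolynomial (Fin n) R) =
      (if k = i then 1 else 0) - (if k = j then 1 else 0) := by
  refine divDiff_unique h ?_
  rw [rename_X, Equiv.swap_apply_def]
  split_ifs with h1 h2 h2
  · exact absurd (h1.symm.trans h2) h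
  · subst h1; ring
  · subst h2; ring
  · ring

theorem divDiff_C (i j : Fin n) (a : R) :
    divDiff i j (C a : MvPolynomial (Fin n) R) = 0 := by
  by_cases h : i = j
  · subst h; simp [divDiff_self]
  · exact divDiff_unique h (by simp)

/-- The Dunkl operator of parameter `c` in the direction of the `i`-th basis vector. -/
noncomputable def dOp (c : R) (i : Fin n) : Module.End R (MvPolynomial (Fin n) R) :=
  ((pderiv i).toLinearMap : MvPolynomial (Fin n) R →ₗ[R] MvPolynomial (Fin n) R) -
    c • ∑ j, divDiffLin i j

theorem dOp_apply (c : R) (i : Fin n) (f : MvPolynomial (Fin n) R) :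
    dOp c i f = pderiv i f - C c * ∑ j, divDiff i j f := by
  simp only [dOp, LinearMap.sub_apply, LinearMap.smul_apply, LinearMap.sum_apply, smul_eq_C_mul]
  rfl

theorem dOp_C (c : R) (i : Fin n) (a : R) : dOp c i (C a) = 0 := by
  simp [dOp_apply, divDiff_C]

theorem rename_dOp (c : R) (σ : Equiv.Perm (Fin n)) (i : Fin n) (f : MvPolynomial (Fin n) R) :
    rename σ (dOp c i f) = dOp c (σ i) (rename σ f) := by
  rw [dOp_apply, dOp_apply, map_sub, map_mul, rename_C, map_sum, pderiv_rename σ.injective]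
  simp only [rename_divDiff]
  rw [Equiv.sum_comp σ fun j => divDiff (σ i) j (rename σ f)]

theorem map_dOp {S : Type*} [CommRing S] [IsDomain S] (φ : R →+* S) (c : R) (i : Fin n)
    (f : MvPolynomial (Fin n) R) : map φ (dOp c i f) = dOp (φ c) i (map φ f) := by
  rw [dOp_apply, dOp_apply, map_sub, map_mul, map_C, map_sum, pderiv_map]
  simp only [map_divDiff]

theorem dOp_X_mul (c : R) (i k : Fin n) (f : MvPolynomial (Fin n) R) :
    dOp c i (X k * f) = X k * dOp c i f + dunklComm c i k f := by
  have key : ∀ j, divDiff i j (X k * f) = X k * divDiff i j f +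
      if i = j then 0 else ((if k = i then 1 else 0) - (if k = j then 1 else 0)) *
        rename (Equiv.swap i j) f := by
    intro j
    by_cases h : i = j
    · subst h; simp [divDiff_self]
    · rw [if_neg h, divDiff_mul, divDiff_X h]
  rw [dOp_apply, dOp_apply]
  simp only [key]
  rw [Finset.sum_add_distrib, ← Finset.mul_sum, pderiv_mul]
  by_cases h : i = k
  · subst h
    rw [dunklComm_self_apply, pderiv_X_self]
    have : (∑ j, if i = j then 0 else ((if i = i then 1 else 0) - (if i = j then 1 else 0)) *
        rename (Equiv.swap i j) f) = ∑ j, if j = i then 0 else rename (Equiv.swap i j) f := by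
      refine Finset.sum_congr rfl fun j _ => ?_
      by_cases hj : i = j
      · simp [hj]
      · simp [hj, Ne.symm hj]
    rw [this]
    ring
  · rw [dunklComm_apply_of_ne c h, pderiv_X_of_ne (Ne.symm h)]
    have : (∑ j, if i = j then 0 else ((if k = i then 1 else 0) - (if k = j then 1 else 0)) *
        rename (Equiv.swap i j) f) = - rename (Equiv.swap i k) f := by
      rw [Finset.sum_eq_single k]
      · simp [h, Ne.symm h]
      · intro j _ hj
        simp [Ne.symm h, Ne.symm hj]
      · simp
    rw [this]
    ring

/-- Induction on `f`: moving a variable `x_k` past both operators leaves the claim that `[∇_i, x_k]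
∇_j + ∇_i [∇_j, x_k]` is symmetric in `i` and `j`. This follows from the equivariance of Dunkl
operators under permutations. -/
theorem dOp_comm_apply (c : R) (i j : Fin n) (f : MvPolynomial (Fin n) R) :
    dOp c i (dOp c j f) = dOp c j (dOp c i f) := by
  by_cases hij : i = j
  · rw [hij]
  induction f using MvPolynomial.induction_on with
  | C a => simp [dOp_C]
  | add p q hp hq => simp only [map_add, hp, hq]
  | mul_X p k hp =>
    rw [mul_comm, dOp_X_mul, dOp_X_mul, map_add, map_add, dOp_X_mul, dOp_X_mul, hp]
    have hC : ∀ (l : Fin n) (g : MvPolynomial (Fin n) R), dOp c l (C c * g) = C c * dOp c l g :=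
      fun l g => by rw [← smul_eq_C_mul, map_smul, smul_eq_C_mul]
    have self_case : ∀ i j : Fin n, i ≠ j → dunklComm c i i (dOp c j p) + dOp c i (dunklComm c j i p)
        = dunklComm c j i (dOp c i p) + dOp c j (dunklComm c i i p) := by
      intro i j hij
      rw [dunklComm_self_apply, dunklComm_self_apply, dunklComm_apply_of_ne c (Ne.symm hij),
        dunklComm_apply_of_ne c (Ne.symm hij), map_sub, hC, hC, map_sum, rename_dOp,
        Equiv.swap_apply_right]
      -- Among the swaps `s_il` only `s_ij` moves the index `j`, so it alone contributes a
      -- correction when `∇_j` is pulled out.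
      have h1 : ∀ l, (if l = i then 0 else rename (Equiv.swap i l) (dOp c j p)) =
          dOp c j (if l = i then 0 else rename (Equiv.swap i l) p) +
          if l = j then dOp c i (rename (Equiv.swap j i) p) -
            dOp c j (rename (Equiv.swap j i) p) else 0 := by
        intro l
        by_cases hl : l = i
        · subst hl; simp [hij]
        · by_cases hl2 : l = j
          · subst hl2
            simp only [hl, if_false, if_true, rename_dOp, Equiv.swap_apply_right]
            rw [Equiv.swap_comm]; ring
          · simp only [hl, hl2, if_false, rename_dOp, add_zero]
            rw [Equiv.swap_apply_of_ne_of_ne (Ne.symm hij) (Ne.symm hl2)]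
      simp only [h1]
      rw [Finset.sum_add_distrib, Finset.sum_ite_eq' Finset.univ j]
      simp only [Finset.mem_univ, if_true]
      ring
    by_cases hki : k = i
    · subst hki
      linear_combination self_case k j hij
    · by_cases hkj : k = j
      · subst hkj
        linear_combination - self_case k i (Ne.symm hij)
      · rw [dunklComm_apply_of_ne c (Ne.symm hki), dunklComm_apply_of_ne c (Ne.symm hkj),
          dunklComm_apply_of_ne c (Ne.symm hki), dunklComm_apply_of_ne c (Ne.symm hkj), hC, hC,
          rename_dOp, rename_dOp, Equiv.swap_apply_of_ne_of_ne (Ne.symm hij) (Ne.symm hkj),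
          Equiv.swap_apply_of_ne_of_ne hij (Ne.symm hki)]
        ring

/-- The twisted Leibniz rule reduces the claim to variables, whose divided differences are
constants. -/
theorem divDiff_isHomogeneous (i j : Fin n) {d : ℕ} :
    ∀ f : MvPolynomial (Fin n) R, f.IsHomogeneous (d + 1) → (divDiff i j f).IsHomogeneous d := by
  by_cases h : i = j
  · subst h
    intro f _
    rw [divDiff_self]
    exact isHomogeneous_zero _ _ _
  have hadd : ∀ f g : MvPolynomial (Fin n) R, divDiff i j (f + g) = divDiff i j f + divDiff i j g :=
    fun f g => map_add (divDiffLin i j) f g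
  have hite : ∀ (a b : Prop) [Decidable a] [Decidable b],
      ((if a then 1 else 0) - (if b then 1 else 0) : MvPolynomial (Fin n) R).IsHomogeneous 0 := by
    intro a b _ _
    have h1 : (1 : MvPolynomial (Fin n) R).IsHomogeneous 0 := isHomogeneous_one _ _
    have h2 : (0 : MvPolynomial (Fin n) R).IsHomogeneous 0 := isHomogeneous_zero _ _ _
    refine IsHomogeneous.sub ?_ ?_ <;> split_ifs <;> assumption
  have h0 : divDiff i j (0 : MvPolynomial (Fin n) R) = 0 := map_zero (divDiffLin i j)
  induction d with
  | zero =>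
    intro f hf
    refine homogeneous_succ_induction (p := fun f => (divDiff i j f).IsHomogeneous 0)
      ?_ (fun f g hf hg => ?_) (fun k f hf => ?_) hf
    · rw [h0]; exact isHomogeneous_zero _ _ _
    · rw [hadd]; exact hf.add hg
    · rw [eq_C_of_isHomogeneous_zero hf, divDiff_mul, divDiff_C, divDiff_X h, mul_zero, zero_add,
        rename_C, mul_comm]
      exact IsHomogeneous.C_mul (hite _ _) _
  | succ d ih =>
    intro f hf
    refine homogeneous_succ_induction (p := fun f => (divDiff i j f).IsHomogeneous (d + 1))
      ?_ (fun f g hf hg => ?_) (fun k f hf => ?_) hf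
    · rw [h0]; exact isHomogeneous_zero _ _ _
    · rw [hadd]; exact hf.add hg
    · rw [divDiff_mul, divDiff_X h]
      refine IsHomogeneous.add ?_ ?_
      · rw [add_comm d]
        exact (isHomogeneous_X _ k).mul (ih _ hf)
      · rw [← zero_add (d + 1)]
        exact IsHomogeneous.mul (hite _ _) hf.rename_isHomogeneous

theorem dOp_isHomogeneous (c : R) (i : Fin n) {d : ℕ} {f : MvPolynomial (Fin n) R}
    (hf : f.IsHomogeneous (d + 1)) : (dOp c i f).IsHomogeneous d := by
  rw [dOp_apply]
  exact (hf.pderiv (i := i)).sub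
    ((IsHomogeneous.sum _ _ _ fun j _ => divDiff_isHomogeneous i j _ hf).C_mul c)

theorem dOp_of_isHomogeneous_zero (c : R) (i : Fin n) {f : MvPolynomial (Fin n) R}
    (hf : f.IsHomogeneous 0) : dOp c i f = 0 := by
  rw [eq_C_of_isHomogeneous_zero hf, dOp_C]

end General

/-! ### The bilinear form, its symmetry, and translation invariance. -/

section Form

variable {R : Type*} [CommRing R] [IsDomain R] {n : ℕ}

/-- The algebra homomorphism sending `x_i` to the `i`-th Dunkl operator. -/
noncomputable def dPoly (c : R) :
    MvPolynomial (Fin n) R →ₐ[R] Module.End R (MvPolynomial (Fin n) R) :=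
  -- `aeval` needs a commutative target, so the homomorphism goes first into the subalgebra
  -- generated by the commuting Dunkl operators and then into all endomorphisms.
  haveI : IsMulCommutative (Algebra.adjoin R (Set.range (dOp (n := n) c))) :=
    Algebra.isMulCommutative_adjoin R (by
      rintro _ ⟨i, rfl⟩ _ ⟨j, rfl⟩
      exact LinearMap.ext fun f => dOp_comm_apply c i j f)
  letI : CommRing (Algebra.adjoin R (Set.range (dOp (n := n) c))) :=
    { (inferInstance : Ring (Algebra.adjoin R (Set.range (dOp (n := n) c)))) with
      mul_comm := mul_comm' }
  (Algebra.adjoin R (Set.range (dOp (n := n) c))).val.comp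
    (aeval fun i => ⟨dOp c i, Algebra.subset_adjoin ⟨i, rfl⟩⟩)

theorem dPoly_X (c : R) (i : Fin n) : dPoly c (X i) = dOp c i := by
  simp [dPoly]

theorem dPoly_monomial (c : R) (m : Fin n →₀ ℕ) (a : R) :
    dPoly c (monomial m a) = a • (List.ofFn fun i : Fin n => dOp c i ^ m i).prod := by
  rw [monomial_eq, Finsupp.prod_fintype _ _ (by simp), ← List.prod_ofFn, map_mul, map_list_prod,
    List.map_ofFn, ← algebraMap_eq, AlgHom.commutes, Algebra.smul_def]
  congr 2
  congr 1
  funext i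
  simp [dPoly_X]

theorem dPoly_X_mul_apply (c : R) (i : Fin n) (f g : MvPolynomial (Fin n) R) :
    dPoly c (X i * f) g = dPoly c f (dOp c i g) := by
  rw [mul_comm, map_mul, dPoly_X]; rfl

theorem dPoly_mul_apply (c : R) (f g h : MvPolynomial (Fin n) R) :
    dPoly c (f * g) h = dPoly c f (dPoly c g h) := by
  rw [map_mul]; rfl

theorem dPoly_C_apply (c a : R) (g : MvPolynomial (Fin n) R) :
    dPoly c (C a) g = C a * g := by
  rw [← algebraMap_eq, AlgHom.commutes, Module.algebraMap_end_apply, smul_eq_C_mul, algebraMap_eq]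

theorem dPoly_comm_apply (c : R) (f g h : MvPolynomial (Fin n) R) :
    dPoly c f (dPoly c g h) = dPoly c g (dPoly c f h) := by
  rw [← dPoly_mul_apply, mul_comm, dPoly_mul_apply]

theorem rename_dPoly (c : R) (σ : Equiv.Perm (Fin n)) (f g : MvPolynomial (Fin n) R) :
    rename σ (dPoly c f g) = dPoly c (rename σ f) (rename σ g) := by
  induction f using MvPolynomial.induction_on generalizing g with
  | C a => rw [rename_C, dPoly_C_apply, dPoly_C_apply, map_mul, rename_C]
  | add p q hp hq => simp only [map_add, LinearMap.add_apply, hp, hq]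
  | mul_X p i hp =>
    rw [mul_comm, dPoly_X_mul_apply, hp, map_mul, rename_X, dPoly_X_mul_apply, rename_dOp]

theorem map_dPoly {S : Type*} [CommRing S] [IsDomain S] (φ : R →+* S) (c : R)
    (f g : MvPolynomial (Fin n) R) :
    map φ (dPoly c f g) = dPoly (φ c) (map φ f) (map φ g) := by
  induction f using MvPolynomial.induction_on generalizing g with
  | C a => rw [map_C, dPoly_C_apply, dPoly_C_apply, map_mul, map_C]
  | add p q hp hq => simp only [map_add, LinearMap.add_apply, hp, hq]
  | mul_X p i hp =>
    rw [mul_comm, dPoly_X_mul_apply, hp, map_mul, map_X, dPoly_X_mul_apply, map_dOp]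

theorem dPoly_isHomogeneous (c : R) {r d : ℕ} : ∀ {f g : MvPolynomial (Fin n) R},
    f.IsHomogeneous r → g.IsHomogeneous (d + r) → (dPoly c f g).IsHomogeneous d := by
  induction r with
  | zero =>
    intro f g hf hg
    rw [eq_C_of_isHomogeneous_zero hf, dPoly_C_apply]
    exact hg.C_mul _
  | succ r ih =>
    intro f g hf hg
    refine homogeneous_succ_induction (p := fun f => (dPoly c f g).IsHomogeneous d)
      ?_ (fun f f' hf hf' => ?_) (fun i f hf => ?_) hf
    · rw [map_zero]; exact isHomogeneous_zero _ _ _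
    · rw [map_add]; exact hf.add hf'
    · rw [dPoly_X_mul_apply]
      exact ih hf (dOp_isHomogeneous c i hg)

theorem dPoly_eq_zero_of_lt (c : R) {r d : ℕ} (hrd : d < r) {f g : MvPolynomial (Fin n) R}
    (hf : f.IsHomogeneous r) (hg : g.IsHomogeneous d) : dPoly c f g = 0 := by
  induction r generalizing d f g with
  | zero => omega
  | succ r ih =>
    refine homogeneous_succ_induction (p := fun f => dPoly c f g = 0)
      (by simp) (fun f f' hf hf' => by simp [hf, hf']) (fun i f hf => ?_) hf
    rw [dPoly_X_mul_apply]
    cases d with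
    | zero => rw [dOp_of_isHomogeneous_zero c i hg, map_zero]
    | succ d => exact ih (by omega) hf (dOp_isHomogeneous c i hg)

/-- The bilinear form of parameter `c`. -/
noncomputable def dForm (c : R) (f g : MvPolynomial (Fin n) R) : R := constantCoeff (dPoly c f g)

theorem dForm_add_left (c : R) (f f' g : MvPolynomial (Fin n) R) :
    dForm c (f + f') g = dForm c f g + dForm c f' g := by
  simp [dForm]

theorem dForm_add_right (c : R) (f g g' : MvPolynomial (Fin n) R) :
    dForm c f (g + g') = dForm c f g + dForm c f g' := by
  simp [dForm]

theorem dForm_sub_left (c : R) (f f' g : MvPolynomial (Fin n) R) :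
    dForm c (f - f') g = dForm c f g - dForm c f' g := by
  simp [dForm]

theorem dForm_sub_right (c : R) (f g g' : MvPolynomial (Fin n) R) :
    dForm c f (g - g') = dForm c f g - dForm c f g' := by
  simp [dForm]

theorem dForm_zero_left (c : R) (g : MvPolynomial (Fin n) R) : dForm c 0 g = 0 := by
  simp [dForm]

theorem dForm_zero_right (c : R) (g : MvPolynomial (Fin n) R) : dForm c g 0 = 0 := by
  simp [dForm]

theorem dForm_C_mul_left (c a : R) (f g : MvPolynomial (Fin n) R) :
    dForm c (C a * f) g = a * dForm c f g := by
  rw [dForm, dPoly_mul_apply, dPoly_C_apply]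
  simp [dForm]

theorem dForm_C_mul_right (c a : R) (f g : MvPolynomial (Fin n) R) :
    dForm c f (C a * g) = a * dForm c f g := by
  rw [dForm, ← smul_eq_C_mul, map_smul, smul_eq_C_mul]
  simp [dForm]

theorem dForm_sum_left {ι : Type*} (c : R) (s : Finset ι) (f : ι → MvPolynomial (Fin n) R)
    (g : MvPolynomial (Fin n) R) : dForm c (∑ i ∈ s, f i) g = ∑ i ∈ s, dForm c (f i) g := by
  simp [dForm, LinearMap.sum_apply]

theorem dForm_sum_right {ι : Type*} (c : R) (s : Finset ι) (f : ι → MvPolynomial (Fin n) R)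
    (g : MvPolynomial (Fin n) R) : dForm c g (∑ i ∈ s, f i) = ∑ i ∈ s, dForm c g (f i) := by
  simp [dForm]

theorem dForm_mul_left (c : R) (f g h : MvPolynomial (Fin n) R) :
    dForm c (f * g) h = dForm c f (dPoly c g h) := by
  rw [dForm, dPoly_mul_apply, dForm]

theorem dForm_X_mul_left (c : R) (i : Fin n) (f g : MvPolynomial (Fin n) R) :
    dForm c (X i * f) g = dForm c f (dOp c i g) := by
  rw [dForm, dPoly_X_mul_apply, dForm]

theorem dForm_C_left (c a : R) (g : MvPolynomial (Fin n) R) :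
    dForm c (C a) g = a * constantCoeff g := by
  rw [dForm, dPoly_C_apply, map_mul, constantCoeff_C]

theorem dForm_rename (c : R) (σ : Equiv.Perm (Fin n)) (f g : MvPolynomial (Fin n) R) :
    dForm c (rename σ f) (rename σ g) = dForm c f g := by
  rw [dForm, ← rename_dPoly, constantCoeff_rename, dForm]

theorem map_dForm {S : Type*} [CommRing S] [IsDomain S] (φ : R →+* S) (c : R)
    (f g : MvPolynomial (Fin n) R) :
    φ (dForm c f g) = dForm (φ c) (map φ f) (map φ g) := by
  rw [dForm, dForm, ← map_dPoly, constantCoeff_map]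

theorem constantCoeff_of_isHomogeneous_succ {A : Type*} [CommRing A] {d : ℕ}
    {f : MvPolynomial (Fin n) A}
    (hf : f.IsHomogeneous (d + 1)) : constantCoeff f = 0 := by
  rw [constantCoeff_eq]
  exact hf.coeff_eq_zero (by simp)

theorem dForm_eq_zero_of_ne (c : R) {r d : ℕ} (hrd : r ≠ d) {f g : MvPolynomial (Fin n) R}
    (hf : f.IsHomogeneous r) (hg : g.IsHomogeneous d) : dForm c f g = 0 := by
  rcases lt_or_gt_of_ne hrd with h | h
  · obtain ⟨e, rfl⟩ := Nat.exists_eq_add_of_lt h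
    rw [dForm]
    refine constantCoeff_of_isHomogeneous_succ (d := e) (dPoly_isHomogeneous c hf ?_)
    convert hg using 1
    omega
  · rw [dForm, dPoly_eq_zero_of_lt c h hf hg, map_zero]

theorem dForm_rename_swap (c : R) (i j : Fin n) (f g : MvPolynomial (Fin n) R) :
    dForm c f (rename (Equiv.swap i j) g) = dForm c (rename (Equiv.swap i j) f) g := by
  rw [← dForm_rename c (Equiv.swap i j) f, rename_rename, ← Equiv.coe_trans, Equiv.swap_swap]
  simp

theorem dForm_dunklComm (c : R) (i k : Fin n) (f g : MvPolynomial (Fin n) R) :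
    dForm c f (dunklComm c i k g) = dForm c (dunklComm c i k f) g := by
  by_cases h : i = k
  · subst h
    rw [dunklComm_self_apply, dunklComm_self_apply, dForm_sub_right, dForm_C_mul_right,
      dForm_sum_right, sub_eq_add_neg f, dForm_add_left, ← neg_mul, ← C_neg, dForm_C_mul_left,
      dForm_sum_left, neg_mul, ← sub_eq_add_neg]
    congr 2
    refine Finset.sum_congr rfl fun j _ => ?_
    split_ifs
    · rw [dForm_zero_left, dForm_zero_right]
    · rw [dForm_rename_swap]
  · rw [dunklComm_apply_of_ne c h, dunklComm_apply_of_ne c h, dForm_C_mul_right,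
      dForm_C_mul_left, dForm_rename_swap]

theorem dunklComm_isHomogeneous {A : Type*} [CommRing A] (c : A) (i k : Fin n)
    {d : ℕ} {f : MvPolynomial (Fin n) A}
    (hf : f.IsHomogeneous d) : (dunklComm c i k f).IsHomogeneous d := by
  by_cases h : i = k
  · subst h
    rw [dunklComm_self_apply]
    refine hf.sub (IsHomogeneous.C_mul (IsHomogeneous.sum _ _ _ fun j _ => ?_) c)
    split_ifs
    · exact isHomogeneous_zero _ _ _
    · exact hf.rename_isHomogeneous
  · rw [dunklComm_apply_of_ne c h]
    exact hf.rename_isHomogeneous.C_mul c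

/-- Expand `(x_i f, x_j g) = (f, x_j ∇_i g) + (f, [∇_i, x_j] g)`. The commutator is symmetric in `i,
j` and self-adjoint, since swaps preserve the form. Two uses of induction turn the first term into a
pairing of `∇_i g` with `∇_j f`. -/
theorem dForm_comm_of_isHomogeneous (c : R) (d : ℕ) : ∀ {f g : MvPolynomial (Fin n) R},
    f.IsHomogeneous d → g.IsHomogeneous d → dForm c f g = dForm c g f := by
  induction d using Nat.strong_induction_on with
  | _ d ih =>
  cases d with
  | zero =>
    intro f g hf hg
    rw [eq_C_of_isHomogeneous_zero hf, eq_C_of_isHomogeneous_zero hg, dForm_C_left, dForm_C_left,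
      constantCoeff_C, constantCoeff_C, mul_comm]
  | succ d =>
    intro f g hf hg
    refine homogeneous_succ_induction (p := fun f => dForm c f g = dForm c g f)
      (by simp [dForm_zero_left, dForm_zero_right])
      (fun f f' h h' => by rw [dForm_add_left, dForm_add_right, h, h']) (fun i f hf => ?_) hf
    refine homogeneous_succ_induction (p := fun g => dForm c (X i * f) g = dForm c g (X i * f))
      (by simp [dForm_zero_left, dForm_zero_right])
      (fun f f' h h' => by rw [dForm_add_left, dForm_add_right, h, h']) (fun j g hg => ?_) hg
    have hmain : dForm c f (X j * dOp c i g) = dForm c g (X i * dOp c j f) := by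
      cases d with
      | zero =>
        rw [dOp_of_isHomogeneous_zero c i hg, dOp_of_isHomogeneous_zero c j hf, mul_zero, mul_zero,
          dForm_zero_right, dForm_zero_right]
      | succ d =>
        have h1 := dOp_isHomogeneous c i hg
        have h2 := dOp_isHomogeneous c j hf
        have h3 : (X j * dOp c i g).IsHomogeneous (d + 1) := by
          rw [add_comm]; exact (isHomogeneous_X _ j).mul h1
        have h4 : (X i * dOp c j f).IsHomogeneous (d + 1) := by
          rw [add_comm]; exact (isHomogeneous_X _ i).mul h2
        rw [ih _ (Nat.lt_succ_self _) hf h3, ih _ (Nat.lt_succ_self _) hg h4, dForm_X_mul_left,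
          dForm_X_mul_left, ih d (by omega) h1 h2]
    rw [dForm_X_mul_left, dForm_X_mul_left, dOp_X_mul, dOp_X_mul, dForm_add_right,
      dForm_add_right, hmain, dForm_dunklComm, dunklComm_symm c j i,
      ih d (Nat.lt_succ_self _) (dunklComm_isHomogeneous c i j hf) hg]

/-- The derivative in the direction `(1, …, 1)`. -/
noncomputable def dSum : Derivation R (MvPolynomial (Fin n) R) (MvPolynomial (Fin n) R) :=
  ∑ i, pderiv i

theorem dSum_apply {A : Type*} [CommRing A] (f : MvPolynomial (Fin n) A) :
    dSum f = ∑ i, pderiv i f := by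
  simp only [dSum]
  rw [← Derivation.coeFnAddMonoidHom_apply, map_sum, Finset.sum_apply]
  rfl

theorem dSum_C_mul {A : Type*} [CommRing A] (a : A) (f : MvPolynomial (Fin n) A) :
    dSum (C a * f) = C a * dSum f := by
  simp only [dSum_apply, pderiv_C_mul, Finset.mul_sum]

/-- The divided differences cancel in pairs by antisymmetry. Hence `∇_{e_1}` does not depend on `c`,
and being translation invariant means being killed by it. -/
theorem sum_dOp (c : R) (f : MvPolynomial (Fin n) R) : ∑ i, dOp c i f = dSum f := by
  have h0 : ∑ i : Fin n, ∑ j, divDiff i j f = 0 := by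
    rw [← Finset.sum_product']
    refine Finset.sum_involution (fun p _ => p.swap) (fun p _ => ?_) (fun p _ hp h => hp ?_)
      (fun p _ => by simp) (fun p _ => by simp)
    · rw [Prod.fst_swap, Prod.snd_swap, divDiff_symm p.1 p.2, add_neg_cancel]
    · have : p.2 = p.1 := congrArg Prod.fst h
      rw [this, divDiff_self]
  simp only [dOp_apply, dSum_apply, Finset.sum_sub_distrib, ← Finset.mul_sum]
  rw [h0, mul_zero, sub_zero]

theorem dPoly_esymm_one (c : R) (f : MvPolynomial (Fin n) R) :
    dPoly c (esymm (Fin n) R 1) f = dSum f := by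
  rw [esymm_one, map_sum, LinearMap.sum_apply, ← sum_dOp c]
  simp only [dPoly_X]

theorem dSum_dPoly (c : R) (f g : MvPolynomial (Fin n) R) :
    dSum (dPoly c f g) = dPoly c f (dSum g) := by
  rw [← dPoly_esymm_one c, dPoly_comm_apply, dPoly_esymm_one]

theorem map_dSum {A : Type*} [CommRing A] {S : Type*} [CommRing S] (φ : A →+* S)
    (f : MvPolynomial (Fin n) A) : map φ (dSum f) = dSum (map φ f) := by
  simp only [dSum_apply, map_sum, pderiv_map]

theorem constantCoeff_divDiff {A : Type*} [CommRing A] (i j : Fin n) (h : MvPolynomial (Fin n) A) :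
    constantCoeff (divDiff i j h) =
      coeff (Finsupp.single i 1) h - coeff (Finsupp.single j 1) h := by
  by_cases hij : i = j
  · subst hij; simp [divDiff_self]
  have h1 := congrArg (coeff (Finsupp.single i 1)) (divDiff_spec hij h)
  rw [sub_mul, coeff_sub, coeff_sub, coeff_single_X_mul, coeff_single_X_mul, if_pos rfl,
    if_neg (Ne.symm hij), sub_zero] at h1
  rw [h1]
  congr 1
  have := coeff_rename_mapDomain (Equiv.swap i j) (Equiv.swap i j).injective h
    (Finsupp.single j 1)
  rwa [Finsupp.mapDomain_single, Equiv.swap_apply_right] at this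

theorem constantCoeff_pderiv {A : Type*} [CommRing A] (i : Fin n) (h : MvPolynomial (Fin n) A) :
    constantCoeff (pderiv i h) = coeff (Finsupp.single i 1) h := by
  rw [constantCoeff_eq, coeff_pderiv]
  simp

/-- Only the linear part `∑ a_j x_j` of `h` matters: the constant term is `a_i - c ∑_j (a_i - a_j)`,
and translation invariance gives `∑ a_j = 0`. This is where the value `1/n` originates. -/
theorem constantCoeff_dOp (c : R) (i : Fin n) {h : MvPolynomial (Fin n) R} (hh : dSum h = 0) :
    constantCoeff (dOp c i h) = (1 - n * c) * coeff (Finsupp.single i 1) h := by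
  have hsum : ∑ j : Fin n, coeff (Finsupp.single j 1) h = 0 := by
    have := congrArg constantCoeff hh
    rw [dSum_apply, map_sum, map_zero] at this
    simpa only [constantCoeff_pderiv] using this
  rw [dOp_apply, map_sub, map_mul, constantCoeff_C, map_sum, constantCoeff_pderiv]
  simp only [constantCoeff_divDiff]
  rw [Finset.sum_sub_distrib, hsum]
  simp
  ring

/-- In a monomial of `f` one variable can be applied last, because the operators commute. The others
preserve translation invariance, so the last one yields the factor `1 - nc`. -/
theorem dvd_dForm (c : R) (f : MvPolynomial (Fin n) R) {h : MvPolynomial (Fin n) R}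
    (hh : dSum h = 0) (h0 : constantCoeff h = 0) : (1 - n * c) ∣ dForm c f h := by
  induction f using MvPolynomial.induction_on with
  | C a => rw [dForm_C_left, h0, mul_zero]; exact dvd_zero _
  | add p q hp hq => rw [dForm_add_left]; exact dvd_add hp hq
  | mul_X p i _ =>
    rw [dForm_mul_left, dForm, dPoly_comm_apply, dPoly_X, constantCoeff_dOp]
    · exact dvd_mul_right _ _
    · rw [dSum_dPoly, hh, map_zero]

end Form

/-! ### Absence of singular polynomials of degree at least 2 at `c = 1/n`. -/

section Singular

variable {n : ℕ}

/-- Multiplication by `x_i - x_j` raises the degree in `x_i` by one, while `g - s_ij g` still has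
all exponents at most `m`. -/
theorem coeff_divDiff_of_degree_le {R : Type*} [CommRing R] [IsDomain R] {i j : Fin n}
    (hij : i ≠ j) {m : ℕ} {g : MvPolynomial (Fin n) R}
    (hg : ∀ α ∈ g.support, ∀ l, α l ≤ m) {γ : Fin n →₀ ℕ} (hγ : m ≤ γ i) :
    coeff γ (divDiff i j g) = 0 := by
  set h := divDiff i j g with hh
  by_contra hne
  have hne0 : h ≠ 0 := by
    rintro e
    rw [e] at hne
    exact hne (coeff_zero _)
  have h1 : degreeOf i ((X i - X j) * h) ≤ m := by
    rw [hh, divDiff_spec hij, degreeOf_le_iff]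
    intro α hα
    rcases Finset.mem_union.mp (support_sub (Fin n) _ _ hα) with h' | h'
    · exact hg α h' i
    · obtain ⟨β, hβ, hβ'⟩ := coeff_rename_ne_zero _ _ _ (mem_support_iff.mp h')
      rw [← hβ, ← Finsupp.equivMapDomain_eq_mapDomain, Finsupp.equivMapDomain_apply]
      exact hg β (mem_support_iff.mpr hβ') _
  rw [degreeOf_mul_eq (X_sub_X_ne_zero hij) hne0] at h1
  have h2 : 1 ≤ degreeOf i (X i - X j : MvPolynomial (Fin n) R) := by
    have : Finsupp.single i 1 ∈ (X i - X j : MvPolynomial (Fin n) R).support := by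
      have hne' : (Finsupp.single j 1 : Fin n →₀ ℕ) ≠ Finsupp.single i 1 := fun e =>
        hij (Finsupp.single_left_injective one_ne_zero e).symm
      rw [mem_support_iff, coeff_sub, coeff_X, coeff_X, if_pos rfl, if_neg hne', sub_zero]
      exact one_ne_zero
    simpa using monomial_le_degreeOf i this
  have h3 := monomial_le_degreeOf i (mem_support_iff.mpr hne)
  omega

/-- Compare coefficients of `x^α` in `(x_i - x_j) · divDiff i j g = g - s_ij g`. The `x_j` term
would need a monomial of degree `m` in `x_i`, which the quotient does not have. If `α j = m`, the
same degree bound applies to `x_j`. -/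
theorem coeff_divDiff_top {R : Type*} [CommRing R] [IsDomain R] {i j : Fin n}
    (hij : i ≠ j) {m : ℕ} (hm : 1 ≤ m) {g : MvPolynomial (Fin n) R}
    (hg : ∀ α ∈ g.support, ∀ l, α l ≤ m) {α : Fin n →₀ ℕ} (hα : α i = m) :
    coeff (α - Finsupp.single i 1) (divDiff i j g) =
      if α j = m then 0 else coeff α g - coeff (Finsupp.equivMapDomain (Equiv.swap i j) α) g := by
  split_ifs with hj
  · rw [divDiff_symm j i, coeff_neg, neg_eq_zero]
    refine coeff_divDiff_of_degree_le (Ne.symm hij) hg ?_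
    simp [hj, hij]
  · have h1 := congrArg (coeff α) (divDiff_spec hij g)
    have h2 : coeff α (rename (Equiv.swap i j) g) =
        coeff (Finsupp.equivMapDomain (Equiv.swap i j) α) g := by
      have := coeff_rename_mapDomain (Equiv.swap i j) (Equiv.swap i j).injective g
        (Finsupp.equivMapDomain (Equiv.swap i j) α)
      rw [← this, ← Finsupp.equivMapDomain_eq_mapDomain, ← Finsupp.equivMapDomain_trans,
        Equiv.swap_swap, Finsupp.equivMapDomain_refl]
    rw [sub_mul, coeff_sub, coeff_sub, coeff_X_mul', coeff_X_mul', h2, if_pos] at h1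
    · rw [← h1]
      split_ifs with h3
      · rw [coeff_divDiff_of_degree_le hij hg (γ := α - Finsupp.single j 1), sub_zero]
        simp [hα, hij]
      · rw [sub_zero]
    · rw [Finsupp.mem_support_iff]
      omega

theorem coeff_dOp_top {R : Type*} [CommRing R] [IsDomain R] (c : R) {i : Fin n}
    {m : ℕ} (hm : 1 ≤ m) {g : MvPolynomial (Fin n) R}
    (hg : ∀ α ∈ g.support, ∀ l, α l ≤ m) {α : Fin n →₀ ℕ} (hα : α i = m) :
    coeff (α - Finsupp.single i 1) (dOp c i g) =
      m * coeff α g - c * ∑ j, if α j = m then 0 else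
        coeff α g - coeff (Finsupp.equivMapDomain (Equiv.swap i j) α) g := by
  have hle : Finsupp.single i 1 ≤ α := by
    rw [Finsupp.single_le_iff]; omega
  rw [dOp_apply, coeff_sub, coeff_C_mul, coeff_sum, coeff_pderiv, tsub_add_cancel_of_le hle]
  congr 1
  · rw [Finsupp.tsub_apply, Finsupp.single_eq_same, hα, mul_comm]
    congr 1
    exact_mod_cast congrArg (Nat.cast (R := R)) (Nat.sub_add_cancel hm)
  · congr 1
    refine Finset.sum_congr rfl fun j _ => ?_
    by_cases hij : i = j
    · subst hij
      rw [divDiff_self, coeff_zero, if_pos hα]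
    · exact coeff_divDiff_top hij hm hg hα

/-- At `c = 1/n`, a polynomial killed by the Dunkl operators has exponents at most `1`. -/
theorem exponent_le_one_of_singular {g : MvPolynomial (Fin n) ℂ}
    (hg : ∀ i, dOp ((n : ℂ)⁻¹) i g = 0) : ∀ α ∈ g.support, ∀ l, α l ≤ 1 := by
  classical
  by_contra! hcon
  obtain ⟨α₀, hα₀, l₀, hl₀⟩ := hcon
  have hn : (n : ℝ) ≠ 0 := by
    have := l₀.pos
    positivity
  obtain ⟨p, hp, hmax⟩ := Finset.exists_max_image (g.support ×ˢ (Finset.univ : Finset (Fin n)))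
    (fun p => p.1 p.2) ⟨(α₀, l₀), by simpa using mem_support_iff.mp hα₀⟩
  set m := p.1 p.2 with hm
  have hbound : ∀ α ∈ g.support, ∀ l, α l ≤ m := fun α hα l =>
    hmax (α, l) (Finset.mem_product.mpr ⟨hα, Finset.mem_univ _⟩)
  have hm2 : 2 ≤ m := le_trans hl₀ (hbound α₀ hα₀ l₀)
  -- A maximum principle: `m` is the largest exponent occurring, and among the monomials attaining
  -- it one with a coefficient of largest modulus `M` is chosen. Swapping variables stays within the
  -- exponents attaining `m`.
  obtain ⟨q, hq, hqmax⟩ := Finset.exists_max_image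
    ((g.support ×ˢ (Finset.univ : Finset (Fin n))).filter fun q => q.1 q.2 = m)
    (fun q => ‖coeff q.1 g‖) ⟨p, Finset.mem_filter.mpr ⟨hp, hm.symm⟩⟩
  obtain ⟨α, i⟩ := q
  simp only [Finset.mem_filter, Finset.mem_product, Finset.mem_univ, and_true] at hq hqmax
  obtain ⟨hα, hαi⟩ := hq
  set M := ‖coeff α g‖ with hM
  have hMpos : 0 < M := norm_pos_iff.mpr (mem_support_iff.mp hα)
  have hle : ∀ β : Fin n →₀ ℕ, ∀ j, β j = m → ‖coeff β g‖ ≤ M := by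
    intro β j hβ
    by_cases h : β ∈ g.support
    · exact hqmax (β, j) ⟨h, hβ⟩
    · rw [notMem_support_iff.mp h, norm_zero]; exact hMpos.le
  have key := coeff_dOp_top ((n : ℂ)⁻¹) (by omega : 1 ≤ m) hbound hαi
  rw [hg i, coeff_zero] at key
  have hn' : (n : ℂ) ≠ 0 := by exact_mod_cast hn
  have key2 : (n : ℂ) * m * coeff α g = ∑ j, if α j = m then 0 else
        coeff α g - coeff (Finsupp.equivMapDomain (Equiv.swap i j) α) g := by
    field_simp at key
    linear_combination - key
  have hnorm : (n : ℝ) * m * M ≤ (n - 1) * (2 * M) := by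
    calc (n : ℝ) * m * M = ‖(n : ℂ) * m * coeff α g‖ := by simp [hM]
      _ ≤ ∑ j, ‖if α j = m then 0 else
        coeff α g - coeff (Finsupp.equivMapDomain (Equiv.swap i j) α) g‖ := by
          rw [key2]; exact norm_sum_le _ _
      _ = ∑ j ∈ Finset.univ.erase i, ‖if α j = m then 0 else
        coeff α g - coeff (Finsupp.equivMapDomain (Equiv.swap i j) α) g‖ := by
          rw [Finset.sum_erase]
          simp [hαi]
      _ ≤ ∑ j ∈ Finset.univ.erase i, 2 * M := by
          refine Finset.sum_le_sum fun j _ => ?_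
          split_ifs
          · rw [norm_zero]; positivity
          · refine (norm_sub_le _ _).trans ?_
            rw [two_mul]
            refine add_le_add le_rfl (hle _ j ?_)
            simp [Finsupp.equivMapDomain_apply, hαi]
      _ = (n - 1) * (2 * M) := by
          rw [Finset.sum_const, Finset.card_erase_of_mem (Finset.mem_univ i), Finset.card_univ,
            Fintype.card_fin, nsmul_eq_mul, Nat.cast_sub i.pos, Nat.cast_one]
  have hm2' : (2 : ℝ) ≤ m := by exact_mod_cast hm2
  have hnpos : (0 : ℝ) < n := by exact_mod_cast i.pos
  -- Since `m ≥ 2`, the left side of `hnorm` is at least `2nM`, which exceeds `2(n - 1)M`.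
  nlinarith [mul_pos hnpos hMpos, mul_le_mul_of_nonneg_left hm2' (mul_pos hnpos hMpos).le]

/-- At `c = 1/n`, there are no singular polynomials of degree at least `2`. -/
theorem eq_zero_of_singular {d : ℕ} (hd : 2 ≤ d) {g : MvPolynomial (Fin n) ℂ}
    (hgd : g.IsHomogeneous d) (hg : ∀ i, dOp ((n : ℂ)⁻¹) i g = 0) : g = 0 := by
  classical
  have hone := exponent_le_one_of_singular hg
  by_contra hne
  obtain ⟨α, hα⟩ := support_nonempty.mpr hne
  have hαd : ∑ j, α j = d := by
    rw [← Finsupp.degree_eq_sum]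
    by_contra h
    exact mem_support_iff.mp hα (hgd.coeff_eq_zero h)
  obtain ⟨i, hi⟩ : ∃ i, α i = 1 := by
    by_contra! h
    have : ∀ j, α j = 0 := fun j => by have := hone α hα j; have := h j; omega
    simp [this] at hαd
    omega
  have hn' : (n : ℂ) ≠ 0 := by
    have := i.pos
    exact_mod_cast this.ne'
  have key := coeff_dOp_top ((n : ℂ)⁻¹) le_rfl hone hi
  rw [hg i, coeff_zero] at key
  have hdsum : dSum g = 0 := by
    rw [← sum_dOp ((n : ℂ)⁻¹)]; simp [hg]
  -- All exponents being 0 or 1, `∇_i g = 0` and translation invariance give two relations between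
  -- the coefficient `g_α` and the sum of its swapped coefficients. Eliminating that sum leaves `(d
  -- - 1) g_α = 0`.
  have key3 := congrArg (coeff (α - Finsupp.single i 1)) hdsum
  rw [dSum_apply, coeff_sum, coeff_zero] at key3
  have hle : Finsupp.single i 1 ≤ α := by
    rw [Finsupp.single_le_iff]; omega
  have hterm : ∀ j, coeff (α - Finsupp.single i 1) (pderiv j g) =
      (if j = i then coeff α g else 0) +
      if α j = 1 then 0 else coeff (Finsupp.equivMapDomain (Equiv.swap i j) α) g := by
    intro j
    rw [coeff_pderiv]
    by_cases hji : j = i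
    · subst hji
      rw [tsub_add_cancel_of_le hle]
      simp [hi]
    · rw [if_neg hji, zero_add]
      have h0 : (α - Finsupp.single i 1 : Fin n →₀ ℕ) j = α j := by simp [hji]
      rw [h0]
      split_ifs with hj
      · have : coeff (α - Finsupp.single i 1 + Finsupp.single j 1) g = 0 := by
          by_contra h
          have := hone _ (mem_support_iff.mpr h) j
          rw [Finsupp.add_apply, h0, hj] at this
          simp at this
        rw [this, zero_mul]
      · have hj0 : α j = 0 := by have := hone α hα j; omega
        rw [hj0]
        have : α - Finsupp.single i 1 + Finsupp.single j 1 =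
            Finsupp.equivMapDomain (Equiv.swap i j) α := by
          ext l
          rw [Finsupp.equivMapDomain_apply, Equiv.symm_swap, Equiv.swap_apply_def]
          by_cases hl : l = i
          · subst hl; simp [hi, hj0, Ne.symm hji]
          · by_cases hl' : l = j
            · subst hl'; simp [hi, hj0, hji]
            · simp [hl, hl']
        rw [this]; simp
  simp only [hterm] at key3
  rw [Finset.sum_add_distrib, Finset.sum_ite_eq' Finset.univ i] at key3
  simp only [Finset.mem_univ, if_true] at key3
  have hcount : (∑ j, if α j = 1 then (0 : ℂ) else coeff α g) = (n - d) * coeff α g := by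
    have : ∀ j, (if α j = 1 then (0 : ℂ) else coeff α g) = (1 - (α j : ℂ)) * coeff α g := by
      intro j
      rcases Nat.le_one_iff_eq_zero_or_eq_one.mp (hone α hα j) with h | h <;> simp [h]
    simp only [this]
    rw [← Finset.sum_mul, Finset.sum_sub_distrib, ← Nat.cast_sum, hαd]
    simp
  have hsplit : (∑ j, if α j = 1 then (0 : ℂ) else
      coeff α g - coeff (Finsupp.equivMapDomain (Equiv.swap i j) α) g) =
      (∑ j, if α j = 1 then (0 : ℂ) else coeff α g) -
      ∑ j, if α j = 1 then 0 else coeff (Finsupp.equivMapDomain (Equiv.swap i j) α) g := by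
    rw [← Finset.sum_sub_distrib]
    refine Finset.sum_congr rfl fun j _ => ?_
    split_ifs <;> ring
  rw [hsplit, hcount] at key
  field_simp at key
  have hfin : ((d : ℂ) - 1) * coeff α g = 0 := by
    push_cast at key
    linear_combination - key - key3
  rcases mul_eq_zero.mp hfin with h | h
  · have : (d : ℂ) = 1 := by linear_combination h
    have : d = 1 := by exact_mod_cast this
    omega
  · exact mem_support_iff.mp hα h

/-- At `c = 1/n`, a translation invariant polynomial of positive degree is detected by the
linear parts of its images under the Dunkl operators. -/
theorem eq_zero_of_linear_parts {d : ℕ} {q : MvPolynomial (Fin n) ℂ}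
    (hq : q.IsHomogeneous (d + 1))
    (h : ∀ f i, coeff (Finsupp.single i 1) (dPoly ((n : ℂ)⁻¹) f q) = 0) : q = 0 := by
  induction d generalizing q with
  | zero =>
    refine MvPolynomial.ext _ _ fun m => ?_
    rw [coeff_zero]
    by_cases hm : m.degree = 1
    · have hm0 : m ≠ 0 := by
        rintro rfl
        simp at hm
      obtain ⟨i, hi⟩ := Finsupp.ne_iff.mp hm0
      have hle : Finsupp.single i 1 ≤ m := by
        rw [Finsupp.single_le_iff]
        exact Nat.one_le_iff_ne_zero.mpr hi
      have h2 := congrArg Finsupp.degree (tsub_add_cancel_of_le hle)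
      rw [map_add, Finsupp.degree_single, hm, Nat.add_eq_right, Finsupp.degree_eq_zero_iff] at h2
      rw [← tsub_add_cancel_of_le hle, h2, zero_add]
      simpa using h 1 i
    · exact hq.coeff_eq_zero (by simpa using hm)
  | succ d ih =>
    -- The hypothesis passes to every `∇_i q`, since `∇_f ∇_i = ∇_{x_i f}`. By induction `q` is
    -- singular, of degree at least 2.
    refine eq_zero_of_singular (by omega) hq fun i => ih (dOp_isHomogeneous _ i hq) fun f j => ?_
    rw [← dPoly_X_mul_apply]
    exact h _ j

end Singular

/-! ### Centred elementary symmetric polynomials are killed by symmetric operators at `c = 1/n`. -/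

section Centered

variable {n : ℕ}

theorem esymm_isHomogeneous (R : Type*) [CommRing R] (k : ℕ) :
    (esymm (Fin n) R k).IsHomogeneous k := by
  refine IsHomogeneous.sum _ _ _ fun t ht => ?_
  have := IsHomogeneous.prod t (fun i => (X i : MvPolynomial (Fin n) R)) (fun _ => 1)
    fun i _ => isHomogeneous_X _ i
  simpa [(Finset.mem_powersetCard.mp ht).2] using this

/-- The centred coordinate `x_i - e_1(x)/n`. -/
noncomputable def xBar (i : Fin n) : SV n := X i - C ((n : ℂ)⁻¹) * esymm (Fin n) ℂ 1

theorem centeredEsymm_eq_aeval (k : ℕ) :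
    centeredEsymm n k = aeval xBar (esymm (Fin n) ℂ k) := rfl

theorem centeredEsymm_eq_sum (k : ℕ) :
    centeredEsymm n k = ∑ t ∈ Finset.powersetCard k Finset.univ, ∏ i ∈ t, xBar i := by
  rw [centeredEsymm_eq_aeval, aeval_esymm_eq_multiset_esymm, Finset.esymm_map_val]

theorem xBar_isHomogeneous (i : Fin n) : (xBar i).IsHomogeneous 1 :=
  (isHomogeneous_X _ i).sub ((esymm_isHomogeneous _ 1).C_mul _)

theorem constantCoeff_xBar (i : Fin n) : constantCoeff (xBar i) = 0 :=
  constantCoeff_of_isHomogeneous_succ (xBar_isHomogeneous i)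

theorem rename_xBar (σ : Equiv.Perm (Fin n)) (i : Fin n) :
    rename σ (xBar i) = xBar (σ i) := by
  rw [xBar, map_sub, map_mul, rename_X, rename_C, rename_esymm, xBar]

theorem pderiv_xBar (i l : Fin n) :
    pderiv i (xBar l) = C ((if l = i then 1 else 0) - (n : ℂ)⁻¹) := by
  have h : pderiv i (esymm (Fin n) ℂ 1) = 1 := by
    rw [esymm_one, map_sum]
    simp [pderiv_X, Pi.single_apply]
  rw [xBar, map_sub, pderiv_C_mul, h, pderiv_X, Pi.single_apply]
  split_ifs <;> simp

theorem dSum_xBar (l : Fin n) : dSum (xBar l) = 0 := by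
  have hn : (n : ℂ) ≠ 0 := by
    have := l.pos
    exact_mod_cast this.ne'
  rw [dSum_apply]
  simp only [pderiv_xBar, ← map_sum]
  rw [Finset.sum_sub_distrib]
  simp [hn]

theorem dSum_aeval_xBar (p : SV n) : dSum (aeval xBar p : SV n) = 0 := by
  induction p using MvPolynomial.induction_on with
  | C a => rw [aeval_C, Derivation.map_algebraMap]
  | add p q hp hq => rw [map_add, map_add, hp, hq, add_zero]
  | mul_X p i hp => rw [map_mul, Derivation.leibniz, hp, aeval_X, dSum_xBar, smul_zero, smul_zero,
      add_zero]

theorem dSum_centeredEsymm (k : ℕ) : dSum (centeredEsymm n k) = 0 := dSum_aeval_xBar _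

theorem centeredEsymm_isHomogeneous (k : ℕ) : (centeredEsymm n k).IsHomogeneous k := by
  have := (esymm_isHomogeneous (n := n) ℂ k).aeval xBar xBar_isHomogeneous
  rwa [one_mul] at this

/-- The product of the `1 + xBar l` over `l ∈ T`. -/
noncomputable def xBarProd (T : Finset (Fin n)) : SV n := ∏ l ∈ T, (1 + xBar l)

theorem constantCoeff_xBarProd (T : Finset (Fin n)) : constantCoeff (xBarProd T) = 1 := by
  simp [xBarProd, constantCoeff_xBar]

theorem rename_xBarProd (σ : Equiv.Perm (Fin n)) (T : Finset (Fin n)) :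
    rename σ (xBarProd T) = xBarProd (T.map σ.toEmbedding) := by
  simp [xBarProd, rename_xBar]

theorem xBarProd_univ : xBarProd Finset.univ = ∑ k ∈ Finset.range (n + 1), centeredEsymm n k := by
  rw [xBarProd, Finset.prod_one_add, Finset.sum_powerset, Finset.card_univ, Fintype.card_fin]
  simp only [centeredEsymm_eq_sum]

theorem pderiv_xBarProd (i : Fin n) (T : Finset (Fin n)) : pderiv i (xBarProd T) =
    ∑ l ∈ T, C ((if l = i then 1 else 0) - (n : ℂ)⁻¹) * xBarProd (T.erase l) := by
  induction T using Finset.induction_on with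
  | empty => simp [xBarProd]
  | insert a T ha ih =>
    have h1 : xBarProd (insert a T) = (1 + xBar a) * xBarProd T := Finset.prod_insert ha
    rw [h1, Finset.sum_insert ha, Finset.erase_insert ha, pderiv_mul, map_add, pderiv_one, zero_add,
      pderiv_xBar, ih, Finset.mul_sum]
    congr 1
    refine Finset.sum_congr rfl fun l hl => ?_
    have hal : a ≠ l := fun e => ha (e ▸ hl)
    have h2 : xBarProd ((insert a T).erase l) = (1 + xBar a) * xBarProd (T.erase l) := by
      rw [Finset.erase_insert_of_ne hal]
      exact Finset.prod_insert fun h => ha (Finset.mem_of_mem_erase h)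
    rw [h2]
    ring

/-- The swap changes only the factor at `i`, and `xBar i - xBar j = x_i - x_j`. -/
theorem divDiff_xBarProd_of_mem {i j : Fin n} {T : Finset (Fin n)} (hi : i ∈ T) (hj : j ∉ T) :
    divDiff i j (xBarProd T) = xBarProd (T.erase i) := by
  have hij : i ≠ j := fun e => hj (e ▸ hi)
  refine divDiff_unique hij ?_
  have h1 : xBarProd T = (1 + xBar i) * xBarProd (T.erase i) := (Finset.mul_prod_erase _ _ hi).symm
  have h2 : rename (Equiv.swap i j) (xBarProd (T.erase i)) = xBarProd (T.erase i) := by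
    rw [xBarProd, map_prod]
    refine Finset.prod_congr rfl fun l hl => ?_
    rw [map_add, map_one, rename_xBar, Equiv.swap_apply_of_ne_of_ne (Finset.ne_of_mem_erase hl)]
    exact fun e => hj (e ▸ Finset.mem_of_mem_erase hl)
  rw [h1, map_mul, h2, map_add, map_one, rename_xBar, Equiv.swap_apply_left, xBar, xBar]
  ring

theorem divDiff_xBarProd_of_iff {i j : Fin n} {T : Finset (Fin n)} (h : i ∈ T ↔ j ∈ T) :
    divDiff i j (xBarProd T) = 0 := by
  by_cases hij : i = j
  · subst hij; exact divDiff_self _ _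
  refine divDiff_unique hij ?_
  have : T.map (Equiv.swap i j).toEmbedding = T := by
    ext l
    rw [Finset.mem_map_equiv, Equiv.symm_swap, Equiv.swap_apply_def]
    split_ifs with h1 h2
    · rw [h1]; exact h.symm
    · rw [h2]; exact h
    · rfl
  rw [rename_xBarProd, this, sub_self, mul_zero]

/-- The span of the products of `t` of the `1 + xBar l`. -/
noncomputable def xBarSpan (n t : ℕ) : Submodule ℂ (SV n) :=
  Submodule.span ℂ (xBarProd '' {T : Finset (Fin n) | T.card = t})

/-- Both the derivative and the divided differences of a product are combinations of the products
with one factor removed. For `t = 0` only constants occur and the result is zero, so truncated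
subtraction is harmless. -/
theorem dOp_mem_xBarSpan (c : ℂ) (i : Fin n) {t : ℕ} {g : SV n} (hg : g ∈ xBarSpan n t) :
    dOp c i g ∈ xBarSpan n (t - 1) := by
  have herase : ∀ (T : Finset (Fin n)) l, T.card = t → l ∈ T →
      xBarProd (T.erase l) ∈ xBarSpan n (t - 1) := fun T l hT hl =>
    Submodule.subset_span ⟨_, by simp [Finset.card_erase_of_mem hl, hT], rfl⟩
  induction hg using Submodule.span_induction with
  | zero => rw [map_zero]; exact Submodule.zero_mem _
  | add x y _ _ hx hy => rw [map_add]; exact Submodule.add_mem _ hx hy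
  | smul a x _ hx => rw [map_smul]; exact Submodule.smul_mem _ _ hx
  | mem x hx =>
    obtain ⟨T, hT, rfl⟩ := hx
    rw [dOp_apply, pderiv_xBarProd]
    refine Submodule.sub_mem _ (Submodule.sum_mem _ fun l hl => ?_) ?_
    · rw [← smul_eq_C_mul]
      exact Submodule.smul_mem _ _ (herase T l hT hl)
    · rw [← smul_eq_C_mul]
      refine Submodule.smul_mem _ _ (Submodule.sum_mem _ fun j _ => ?_)
      by_cases hi : i ∈ T
      · by_cases hj : j ∈ T
        · rw [divDiff_xBarProd_of_iff (by tauto)]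
          exact Submodule.zero_mem _
        · rw [divDiff_xBarProd_of_mem hi hj]
          exact herase T i hT hi
      · by_cases hj : j ∈ T
        · rw [divDiff_symm, divDiff_xBarProd_of_mem hj hi]
          exact Submodule.neg_mem _ (herase T j hT hj)
        · rw [divDiff_xBarProd_of_iff (by tauto)]
          exact Submodule.zero_mem _

theorem dPoly_mem_xBarSpan (c : ℂ) {r : ℕ} {f : SV n} (hf : f.IsHomogeneous r) :
    ∀ {t : ℕ} {g : SV n}, g ∈ xBarSpan n t → dPoly c f g ∈ xBarSpan n (t - r) := by
  induction r generalizing f with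
  | zero =>
    intro t g hg
    rw [eq_C_of_isHomogeneous_zero hf, dPoly_C_apply, ← smul_eq_C_mul]
    exact Submodule.smul_mem _ _ hg
  | succ r ih =>
    intro t g hg
    refine homogeneous_succ_induction (p := fun f => dPoly c f g ∈ xBarSpan n (t - (r + 1)))
      (by simp) (fun f f' h h' => ?_) (fun i f hf => ?_) hf
    · rw [map_add]; exact Submodule.add_mem _ h h'
    · rw [dPoly_X_mul_apply, show t - (r + 1) = t - 1 - r by omega]
      exact ih hf (dOp_mem_xBarSpan c i hg)

theorem exists_perm_map_eq {S T : Finset (Fin n)} (h : S.card = T.card) :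
    ∃ σ : Equiv.Perm (Fin n), S.map σ.toEmbedding = T := by
  let e : {x // x ∈ S} ≃ {x // x ∈ T} := Finset.equivOfCardEq h
  refine ⟨e.extendSubtype, Finset.eq_of_subset_of_card_le (fun x hx => ?_) (by simp [h])⟩
  obtain ⟨y, hy, rfl⟩ := Finset.mem_map.mp hx
  exact e.extendSubtype_mem y hy

/-- The group permutes the `t`-subsets transitively, so all the spanning products have the same
symmetrization `G`, and each has constant term 1. Up to scalars there is thus at most one symmetric
element in the span, recognized by its constant term. -/
theorem exists_sum_rename_xBarSpan (t : ℕ) : ∃ G : SV n, ∀ g ∈ xBarSpan n t,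
    ∑ σ : Equiv.Perm (Fin n), rename σ g = C (constantCoeff g) * G := by
  by_cases hT : ∃ T : Finset (Fin n), T.card = t
  · obtain ⟨T₀, hT₀⟩ := hT
    refine ⟨∑ σ : Equiv.Perm (Fin n), rename σ (xBarProd T₀), fun g hg => ?_⟩
    induction hg using Submodule.span_induction with
    | zero => simp
    | add x y _ _ hx hy =>
      simp only [map_add, Finset.sum_add_distrib]
      rw [hx, hy, add_mul]
    | smul a x _ hx =>
      simp only [smul_eq_C_mul, map_mul, rename_C, constantCoeff_C]
      rw [← Finset.mul_sum, hx, mul_assoc]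
    | mem x hx =>
      obtain ⟨T, hT, rfl⟩ := hx
      obtain ⟨τ, hτ⟩ := exists_perm_map_eq (hT.trans hT₀.symm : T.card = T₀.card)
      rw [constantCoeff_xBarProd, C_1, one_mul, ← hτ, ← rename_xBarProd]
      simp only [rename_rename, ← Equiv.Perm.coe_mul]
      exact (Equiv.sum_comp (Equiv.mulRight τ) fun σ => rename σ (xBarProd T)).symm
  · refine ⟨0, fun g hg => ?_⟩
    have : {T : Finset (Fin n) | T.card = t} = ∅ :=
      Set.eq_empty_iff_forall_notMem.mpr fun T hT' => hT ⟨T, hT'⟩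
    rw [xBarSpan, this, Set.image_empty, Submodule.span_empty, Submodule.mem_bot] at hg
    simp [hg]

theorem eq_zero_of_mem_xBarSpan {t : ℕ} {g : SV n} (hg : g ∈ xBarSpan n t) (hs : g.IsSymmetric)
    (h0 : constantCoeff g = 0) : g = 0 := by
  obtain ⟨G, hG⟩ := exists_sum_rename_xBarSpan (n := n) t
  have h1 := hG g hg
  have h2 : ∀ σ : Equiv.Perm (Fin n), rename σ g = g := hs
  simp only [h2] at h1
  rw [h0, C_0, zero_mul, Finset.sum_const, Finset.card_univ, smul_eq_zero] at h1
  exact h1.resolve_left Fintype.card_ne_zero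

theorem dForm_inv_eq_zero (f : SV n) {h : SV n} (hh : dSum h = 0) (h0 : constantCoeff h = 0) :
    dForm ((n : ℂ)⁻¹) f h = 0 := by
  rcases Nat.eq_zero_or_pos n with rfl | hn
  -- For `n = 0` there are no variables, so `h` is its constant term.
  · rw [show h = C (constantCoeff h) by rw [constantCoeff_eq]; exact eq_C_of_isEmpty h, h0, C_0,
      dForm_zero_right]
  · have := dvd_dForm ((n : ℂ)⁻¹) f hh h0
    rwa [mul_inv_cancel₀ (by exact_mod_cast hn.ne'), sub_self, zero_dvd_iff] at this

theorem dPoly_isSymmetric {R : Type*} [CommRing R] [IsDomain R] (c : R)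
    {f g : MvPolynomial (Fin n) R} (hf : f.IsSymmetric) (hg : g.IsSymmetric) :
    (dPoly c f g).IsSymmetric := fun σ => by rw [rename_dPoly, hf σ, hg σ]

/-- At `c = 1/n`, the operators of homogeneous symmetric polynomials of positive degree kill the
centred elementary symmetric polynomials. -/
theorem dPoly_centeredEsymm {k r : ℕ} (hk : k ≤ n) {f : SV n} (hf : f.IsHomogeneous (r + 1))
    (hs : f.IsSymmetric) : dPoly ((n : ℂ)⁻¹) f (centeredEsymm n k) = 0 := by
  -- The full product is the generating function `∑ ē_j`. Its image under `∇_f` is a symmetric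
  -- element of one span, and its constant term vanishes at `c = 1/n` by the factor `1 - nc`.
  have h1 : dPoly ((n : ℂ)⁻¹) f (xBarProd Finset.univ) = 0 := by
    refine eq_zero_of_mem_xBarSpan (t := n - (r + 1)) (dPoly_mem_xBarSpan _ hf
      (Submodule.subset_span ⟨Finset.univ, by simp, rfl⟩)) (dPoly_isSymmetric _ hs fun σ => ?_) ?_
    · rw [rename_xBarProd, Finset.map_univ_equiv]
    · rw [xBarProd_univ, map_sum, map_sum]
      refine Finset.sum_eq_zero fun j _ => ?_
      cases j with
      | zero =>
        rw [dPoly_eq_zero_of_lt _ (Nat.succ_pos r) hf (centeredEsymm_isHomogeneous 0), map_zero]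
      | succ j =>
        exact dForm_inv_eq_zero f (dSum_centeredEsymm _)
          (constantCoeff_of_isHomogeneous_succ (centeredEsymm_isHomogeneous (j + 1)))
  by_cases hkr : k < r + 1
  · exact dPoly_eq_zero_of_lt _ hkr hf (centeredEsymm_isHomogeneous k)
  have hhom : ∀ j, r + 1 ≤ j →
      (dPoly ((n : ℂ)⁻¹) f (centeredEsymm n j)).IsHomogeneous (j - (r + 1)) := fun j hj =>
    dPoly_isHomogeneous _ hf (by rw [Nat.sub_add_cancel hj]; exact centeredEsymm_isHomogeneous j)
  rw [xBarProd_univ, map_sum] at h1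
  -- Only the summand `j = k` contributes in degree `k - (r + 1)`; the `j < r + 1` vanish by degree.
  have h2 := congrArg (homogeneousComponent (k - (r + 1))) h1
  rw [map_sum, map_zero, Finset.sum_eq_single k] at h2
  · rwa [homogeneousComponent_eq_self (hhom k (by omega))] at h2
  · intro j _ hjk
    by_cases hjr : j < r + 1
    · rw [dPoly_eq_zero_of_lt _ hjr hf (centeredEsymm_isHomogeneous j), map_zero]
    · rw [homogeneousComponent_of_mem (hhom j (by omega)), if_neg (by omega)]
  · intro h
    exact absurd (Finset.mem_range.mpr (by omega)) h

end Centered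

/-! ### Polynomials in the elementary symmetric polynomials of low degree. -/

section Symmetric

variable {R : Type*} [CommRing R] {n : ℕ}

/-- The algebra homomorphism sending the `i`-th variable to the `i`-th elementary symmetric
polynomial. -/
noncomputable def esHom (R : Type*) [CommRing R] (n : ℕ) :
    MvPolynomial (Fin n) R →ₐ[R] MvPolynomial (Fin n) R :=
  aeval fun i : Fin n => esymm (Fin n) R (i + 1)

theorem esHom_X (i : Fin n) : esHom R n (X i) = esymm (Fin n) R (i + 1) := by simp [esHom]

theorem esHom_C (a : R) : esHom R n (C a) = C a := by simp [esHom, algebraMap_eq]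

theorem esHom_injective : Function.Injective (esHom R n) := fun p q h =>
  esymmAlgHom_fin_injective R le_rfl (Subtype.ext (by
    rw [esymmAlgHom_apply, esymmAlgHom_apply]; exact h))

theorem exists_esHom_eq {f : MvPolynomial (Fin n) R} (hf : f.IsSymmetric) :
    ∃ Q, esHom R n Q = f := by
  obtain ⟨Q, hQ⟩ := esymmAlgHom_fin_surjective R (le_refl n) ⟨f, hf⟩
  refine ⟨Q, ?_⟩
  have := congrArg Subtype.val hQ
  rwa [esymmAlgHom_apply] at this

theorem esHom_isSymmetric (Q : MvPolynomial (Fin n) R) : (esHom R n Q).IsSymmetric := by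
  have h := (esymmAlgHom (Fin n) R n Q).2
  rw [esymmAlgHom_apply] at h
  exact h

theorem map_esHom {S : Type*} [CommRing S] (φ : R →+* S) (Q : MvPolynomial (Fin n) R) :
    map φ (esHom R n Q) = esHom S n (map φ Q) := by
  induction Q using MvPolynomial.induction_on with
  | C a => rw [esHom_C, map_C, esHom_C]
  | add p q hp hq => simp only [map_add, hp, hq]
  | mul_X p i hp => simp only [map_mul, hp, esHom_X, map_X, map_esymm]

/-- The polynomials in the variables of index (counted from `1`) less than `k`. -/
noncomputable def lowVars (R : Type*) [CommRing R] (n k : ℕ) :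
    Subalgebra R (MvPolynomial (Fin n) R) :=
  supported R {i : Fin n | (i : ℕ) + 1 < k}

theorem monomial_eq_X_mul {i : Fin n} {m : Fin n →₀ ℕ} (hi : m i ≠ 0) (a : R) :
    monomial m a = X i * monomial (m - Finsupp.single i 1) a := by
  rw [X, monomial_mul, one_mul, add_tsub_cancel_of_le]
  rw [Finsupp.single_le_iff]
  exact Nat.one_le_iff_ne_zero.mpr hi

theorem mem_lowVars_iff {k : ℕ} {Q : MvPolynomial (Fin n) R} :
    Q ∈ lowVars R n k ↔ ∀ m ∈ Q.support, ∀ i : Fin n, m i ≠ 0 → (i : ℕ) + 1 < k := by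
  rw [lowVars, mem_supported]
  constructor
  · intro h m hm i hi
    exact h (mem_vars_iff_mem_support i |>.mpr ⟨m, hm, Finsupp.mem_support_iff.mpr hi⟩)
  · intro h i hi
    obtain ⟨m, hm, hi⟩ := (mem_vars_iff_mem_support i).mp hi
    exact h m hm i (Finsupp.mem_support_iff.mp hi)

theorem monomial_mem_lowVars {k : ℕ} {m : Fin n →₀ ℕ} (h : ∀ i : Fin n, m i ≠ 0 → (i : ℕ) + 1 < k)
    (a : R) : monomial m a ∈ lowVars R n k := by
  rw [mem_lowVars_iff]
  intro m' hm'
  rw [Finset.mem_singleton.mp (support_monomial_subset hm')]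
  exact h

theorem X_mem_lowVars {k : ℕ} {i : Fin n} (h : (i : ℕ) + 1 < k) :
    (X i : MvPolynomial (Fin n) R) ∈ lowVars R n k :=
  Algebra.subset_adjoin ⟨i, h, rfl⟩

theorem C_mem_lowVars {k : ℕ} (a : R) : (C a : MvPolynomial (Fin n) R) ∈ lowVars R n k :=
  Subalgebra.algebraMap_mem _ a

theorem map_mem_lowVars {S : Type*} [CommRing S] (φ : R →+* S) {k : ℕ}
    {Q : MvPolynomial (Fin n) R} (hQ : Q ∈ lowVars R n k) : map φ Q ∈ lowVars S n k := by
  rw [mem_lowVars_iff] at hQ ⊢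
  exact fun m hm => hQ m (support_map_subset _ _ hm)

theorem mem_lowVars_of_map {S : Type*} [CommRing S] {φ : R →+* S} (hφ : Function.Injective φ)
    {k : ℕ} {Q : MvPolynomial (Fin n) R} (hQ : map φ Q ∈ lowVars S n k) : Q ∈ lowVars R n k := by
  rw [mem_lowVars_iff] at hQ ⊢
  rwa [support_map_of_injective _ hφ] at hQ

theorem lowVars_induction {k : ℕ} {p : MvPolynomial (Fin n) R → Prop} (hC : ∀ a, p (C a))
    (hadd : ∀ f g, p f → p g → p (f + g))
    (hmul : ∀ i : Fin n, (i : ℕ) + 1 < k → ∀ Q ∈ lowVars R n k, p (X i * Q))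
    {Q : MvPolynomial (Fin n) R} (hQ : Q ∈ lowVars R n k) : p Q := by
  rw [mem_lowVars_iff] at hQ
  rw [Q.as_sum]
  refine Finset.sum_induction _ p hadd (by simpa using hC 0) fun m hm => ?_
  by_cases hm0 : m = 0
  · subst hm0
    exact hC _
  · obtain ⟨i, hi⟩ := Finsupp.ne_iff.mp hm0
    rw [monomial_eq_X_mul hi]
    refine hmul i (hQ m hm i hi) _ (monomial_mem_lowVars (fun j hj => hQ m hm j fun h => hj ?_) _)
    rw [Finsupp.tsub_apply, h, Nat.zero_sub]

theorem induction_of_lowVars (k : ℕ) {p : MvPolynomial (Fin n) R → Prop}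
    (hadd : ∀ f g, p f → p g → p (f + g)) (hlow : ∀ Q ∈ lowVars R n k, p Q)
    (hmul : ∀ i : Fin n, k ≤ (i : ℕ) + 1 → ∀ Q, p (X i * Q))
    (Q : MvPolynomial (Fin n) R) : p Q := by
  rw [Q.as_sum]
  refine Finset.sum_induction _ p hadd (hlow 0 (Subalgebra.zero_mem _)) fun m _ => ?_
  by_cases h : ∃ i : Fin n, m i ≠ 0 ∧ k ≤ (i : ℕ) + 1
  · obtain ⟨i, hi, hk⟩ := h
    rw [monomial_eq_X_mul hi]
    exact hmul i hk _
  · push Not at h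
    exact hlow _ (monomial_mem_lowVars h _)

theorem esymm_mem_map_lowVars {j k : ℕ} (hj : j < k) (hk : k ≤ n + 1) :
    esymm (Fin n) R j ∈ (lowVars R n k).map (esHom R n) := by
  cases j with
  | zero => rw [esymm_zero]; exact Subalgebra.one_mem _
  | succ j => exact ⟨X ⟨j, by omega⟩, X_mem_lowVars hj, esHom_X _⟩

/-- With `s = e_1/n`, substitute `T - s` for `T` in `∏ (T + x_i)` and read off the coefficient of
`T^(n-k)`. -/
theorem centeredEsymm_eq_sum_esymm {k : ℕ} (hk : k ≤ n) : centeredEsymm n k =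
    ∑ j ∈ Finset.range (k + 1), esymm (Fin n) ℂ j *
      ((-(C ((n : ℂ)⁻¹) * esymm (Fin n) ℂ 1)) ^ (k - j) * ((n - j).choose (n - k) : SV n)) := by
  set s : SV n := C ((n : ℂ)⁻¹) * esymm (Fin n) ℂ 1 with hs
  have h1 := Finset.prod_X_add_C_coeff (Finset.univ : Finset (Fin n)) (xBar (n := n))
    (k := n - k) (by simp)
  rw [Finset.card_univ, Fintype.card_fin, Nat.sub_sub_self hk, ← centeredEsymm_eq_sum] at h1
  have h2 : (∏ i : Fin n, (Polynomial.X + Polynomial.C (xBar i))) =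
      (∏ i : Fin n, (Polynomial.X + Polynomial.C (X i : SV n))).comp
        (Polynomial.X + Polynomial.C (-s)) := by
    rw [Polynomial.prod_comp]
    refine Finset.prod_congr rfl fun i _ => ?_
    rw [Polynomial.add_comp, Polynomial.X_comp, Polynomial.C_comp, xBar, map_sub, map_neg]
    ring
  rw [← h1, h2, MvPolynomial.prod_C_add_X_eq_sum_esymm,
    ← Polynomial.coe_compRingHom_apply, map_sum, Polynomial.finsetSum_coeff, Fintype.card_fin]
  simp only [Polynomial.coe_compRingHom_apply, Polynomial.mul_comp, Polynomial.C_comp,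
    Polynomial.pow_comp, Polynomial.X_comp,
    Polynomial.coeff_C_mul, Polynomial.coeff_X_add_C_pow]
  refine (Finset.sum_subset_zero_on_sdiff (fun j hj => ?_) (fun j hj => ?_) fun j hj => ?_).symm
  · rw [Finset.mem_range] at hj ⊢; omega
  · rw [Finset.mem_sdiff, Finset.mem_range, Finset.mem_range] at hj
    rw [Nat.choose_eq_zero_of_lt (by omega)]
    simp
  · rw [Finset.mem_range] at hj
    rw [show n - j - (n - k) = k - j by omega]

/-- Each term with `j < k` in the expansion contains a positive power of `e_1`. The factor `e_1` is
kept apart because `∇_{e_1}` kills translation invariant polynomials. -/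
theorem exists_centeredEsymm_eq {k : ℕ} (hk : 2 ≤ k) (hkn : k ≤ n) :
    ∃ Q ∈ lowVars ℂ n k, centeredEsymm n k =
      esymm (Fin n) ℂ k + esymm (Fin n) ℂ 1 * esHom ℂ n Q := by
  have h1 := centeredEsymm_eq_sum_esymm hkn
  rw [Finset.sum_range_succ] at h1
  have h2 : ∀ j ∈ Finset.range k, esymm (Fin n) ℂ j *
      ((-(C ((n : ℂ)⁻¹) * esymm (Fin n) ℂ 1)) ^ (k - j) * ((n - j).choose (n - k) : SV n)) =
      esymm (Fin n) ℂ 1 * (- C ((n : ℂ)⁻¹) * (esymm (Fin n) ℂ j *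
      ((-(C ((n : ℂ)⁻¹) * esymm (Fin n) ℂ 1)) ^ (k - j - 1) *
        ((n - j).choose (n - k) : SV n)))) := by
    intro j hj
    rw [Finset.mem_range] at hj
    obtain ⟨e, he⟩ := Nat.exists_eq_add_of_lt hj
    rw [show k - j = e + 1 by omega, Nat.add_sub_cancel, pow_succ]
    ring
  rw [Finset.sum_congr rfl h2, ← Finset.mul_sum, Nat.sub_self, Nat.choose_self, pow_zero,
    Nat.cast_one, mul_one, mul_one] at h1
  have h3 : ∑ j ∈ Finset.range k, (- C ((n : ℂ)⁻¹) * (esymm (Fin n) ℂ j *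
      ((-(C ((n : ℂ)⁻¹) * esymm (Fin n) ℂ 1)) ^ (k - j - 1) *
        ((n - j).choose (n - k) : SV n)))) ∈ (lowVars ℂ n k).map (esHom ℂ n) := by
    have hC : ∀ a : ℂ, (C a : SV n) ∈ (lowVars ℂ n k).map (esHom ℂ n) := fun a =>
      Subalgebra.algebraMap_mem _ a
    refine Subalgebra.sum_mem _ fun j hj => ?_
    refine Subalgebra.mul_mem _ (Subalgebra.neg_mem _ (hC _)) (Subalgebra.mul_mem _
      (esymm_mem_map_lowVars (Finset.mem_range.mp hj) (by omega)) (Subalgebra.mul_mem _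
      (Subalgebra.pow_mem _ (Subalgebra.neg_mem _ (Subalgebra.mul_mem _ (hC _)
        (esymm_mem_map_lowVars (by omega) (by omega)))) _) (Subalgebra.natCast_mem _ _)))
  obtain ⟨Q, hQ, hQ'⟩ := h3
  refine ⟨Q, hQ, ?_⟩
  rw [h1, ← hQ', add_comm]
  rfl

end Symmetric

/-! ### Reduction of pairings to low symmetric polynomials. -/

section Averaging

variable {R : Type*} [CommRing R] [IsDomain R] [Algebra ℂ R] {n : ℕ}

/-- The form is invariant and `w` symmetric, so the symmetrization of `f` pairs with `w` to `n!`
times the pairing of `f`; and `n!` is invertible over `ℂ`. An ideal serves both divisibility (a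
principal ideal) and vanishing (the zero ideal). -/
theorem dForm_mem_of_symmetric (c : R) (I : Ideal R) {w : MvPolynomial (Fin n) R}
    (hw : w.IsSymmetric) (h : ∀ Q, dForm c (esHom R n Q) w ∈ I) (f : MvPolynomial (Fin n) R) :
    dForm c f w ∈ I := by
  have hs : (∑ σ : Equiv.Perm (Fin n), rename σ f).IsSymmetric := by
    intro τ
    rw [map_sum]
    simp only [rename_rename, ← Equiv.Perm.coe_mul]
    exact Equiv.sum_comp (Equiv.mulLeft τ) fun σ => rename σ f
  obtain ⟨Q, hQ⟩ := exists_esHom_eq hs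
  have h1 := h Q
  have h2 : ∀ σ : Equiv.Perm (Fin n), dForm c (rename σ f) w = dForm c f w := fun σ => by
    conv_lhs => rw [← hw σ]
    rw [dForm_rename]
  rw [hQ, dForm_sum_left] at h1
  simp only [h2] at h1
  rw [Finset.sum_const, Finset.card_univ, nsmul_eq_mul] at h1
  have h3 := I.mul_mem_left
    (algebraMap ℂ R ((Fintype.card (Equiv.Perm (Fin n)) : ℂ)⁻¹)) h1
  rwa [← mul_assoc, ← map_natCast (algebraMap ℂ R), ← map_mul, inv_mul_cancel₀, map_one,
    one_mul] at h3
  exact_mod_cast Fintype.card_ne_zero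

theorem dForm_mem_of_lowVars (c : R) (I : Ideal R) (k : ℕ) {w : MvPolynomial (Fin n) R}
    (hw : w.IsSymmetric) (hlow : ∀ Q ∈ lowVars R n k, dForm c (esHom R n Q) w ∈ I)
    (hhigh : ∀ i : Fin n, k ≤ (i : ℕ) + 1 → ∀ Q,
      dForm c (esHom R n Q) (dPoly c (esymm (Fin n) R (i + 1)) w) ∈ I)
    (f : MvPolynomial (Fin n) R) : dForm c f w ∈ I := by
  refine dForm_mem_of_symmetric c I hw (fun Q => ?_) f
  refine induction_of_lowVars k (p := fun Q => dForm c (esHom R n Q) w ∈ I)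
    (fun f g hf hg => ?_) hlow (fun i hi Q => ?_) Q
  · rw [map_add, dForm_add_left]; exact I.add_mem hf hg
  · rw [mul_comm, map_mul, esHom_X, dForm_mul_left]
    exact hhigh i hi Q

end Averaging

/-! ### Second order vanishing at `c = 1/n`. -/

section Specialization

open scoped Polynomial

variable {n : ℕ}

/-- The element `X - 1/n` of `ℂ[X]`. -/
noncomputable def unif (n : ℕ) : ℂ[X] := Polynomial.X - Polynomial.C ((n : ℂ)⁻¹)

/-- Specialization at `1/n`. -/
noncomputable def spec (n : ℕ) : ℂ[X] →+* ℂ := Polynomial.evalRingHom ((n : ℂ)⁻¹)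

theorem spec_eq_zero_iff (p : ℂ[X]) : spec n p = 0 ↔ unif n ∣ p := by
  rw [unif, Polynomial.dvd_iff_isRoot]; rfl

theorem spec_X : spec n Polynomial.X = (n : ℂ)⁻¹ := by simp [spec]

theorem spec_C (a : ℂ) : spec n (Polynomial.C a) = a := by simp [spec]

theorem map_spec_eq_zero_iff (f : MvPolynomial (Fin n) ℂ[X]) :
    map (spec n) f = 0 ↔ C (unif n) ∣ f :=
  (C_dvd_iff_map_hom_eq_zero _ _ spec_eq_zero_iff f).symm

theorem unif_ne_zero : unif n ≠ 0 := Polynomial.X_sub_C_ne_zero _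

theorem one_sub_eq (hn : n ≠ 0) :
    1 - (n : ℂ[X]) * Polynomial.X = Polynomial.C (-(n : ℂ)) * unif n := by
  have h : (Polynomial.C (n : ℂ) * Polynomial.C ((n : ℂ)⁻¹) : ℂ[X]) = 1 := by
    rw [← map_mul, mul_inv_cancel₀ (by exact_mod_cast hn), map_one]
  rw [unif, map_neg, ← Polynomial.C_eq_natCast]
  linear_combination -h

theorem unif_dvd_one_sub (hn : n ≠ 0) : unif n ∣ 1 - (n : ℂ[X]) * Polynomial.X :=
  ⟨_, (one_sub_eq hn).trans (mul_comm _ _)⟩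

theorem map_spec_map_C (f : SV n) : map (spec n) (map Polynomial.C f) = f := by
  rw [map_map]
  convert map_id f
  exact RingHom.ext fun a => spec_C a

/-- The pairing of a centred elementary symmetric polynomial with polynomials in elementary
symmetric polynomials of lower degree vanishes to the second order at `c = 1/n`. -/
theorem unif_sq_dvd_dForm_centeredEsymm {k : ℕ} (hk : 2 ≤ k) (hkn : k ≤ n)
    {Q : MvPolynomial (Fin n) ℂ[X]} (hQ : Q ∈ lowVars ℂ[X] n k) :
    unif n ^ 2 ∣ dForm Polynomial.X (esHom ℂ[X] n Q) (map Polynomial.C (centeredEsymm n k)) := by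
  have hhom : (map Polynomial.C (centeredEsymm n k)).IsHomogeneous k :=
    (centeredEsymm_isHomogeneous k).map _
  refine lowVars_induction (p := fun Q => unif n ^ 2 ∣ dForm Polynomial.X (esHom ℂ[X] n Q)
    (map Polynomial.C (centeredEsymm n k))) (fun a => ?_) (fun f g hf hg => ?_)
    (fun i hi Q _ => ?_) hQ
  · rw [esHom_C, dForm_C_left, constantCoeff_of_isHomogeneous_succ (d := k - 1), mul_zero]
    · exact dvd_zero _
    · rwa [Nat.sub_add_cancel (by omega)]
  · rw [map_add, dForm_add_left]; exact dvd_add hf hg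
  · rw [mul_comm, map_mul, esHom_X, dForm_mul_left]
    set G := dPoly Polynomial.X (esymm (Fin n) ℂ[X] (i + 1)) (map Polynomial.C (centeredEsymm n k))
      with hG
    -- The first factor `c - 1/n`: `∇_{e_i} ē_k` vanishes at `c = 1/n`. Its quotient `H` by `c -
    -- 1/n` is still translation invariant without constant term, so its pairings supply the second
    -- factor.
    have h1 : map (spec n) G = 0 := by
      rw [hG, map_dPoly, spec_X, map_spec_map_C, map_esymm]
      exact dPoly_centeredEsymm hkn (esymm_isHomogeneous _ _) (esymm_isSymmetric _ _ _)
    obtain ⟨H, hH⟩ := (map_spec_eq_zero_iff G).mp h1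
    have hGhom : G.IsHomogeneous (k - (i + 1) - 1 + 1) := by
      refine dPoly_isHomogeneous _ (esymm_isHomogeneous _ _) ?_
      rwa [show k - (i + 1) - 1 + 1 + (i + 1) = k by omega]
    have hC0 : (C (unif n) : MvPolynomial (Fin n) ℂ[X]) ≠ 0 :=
      (map_ne_zero_iff C (C_injective _ _)).mpr unif_ne_zero
    have hH0 : constantCoeff H = 0 := by
      have := constantCoeff_of_isHomogeneous_succ hGhom
      rw [hH, map_mul, constantCoeff_C] at this
      exact (mul_eq_zero.mp this).resolve_left unif_ne_zero
    have hHs : dSum H = 0 := by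
      have : dSum G = 0 := by
        rw [hG, dSum_dPoly, ← map_dSum, dSum_centeredEsymm, map_zero, map_zero]
      rw [hH, dSum_C_mul] at this
      exact (mul_eq_zero.mp this).resolve_left hC0
    rw [hH, dForm_C_mul_right, sq]
    exact mul_dvd_mul_left _ ((unif_dvd_one_sub (by omega)).trans (dvd_dForm _ _ hHs hH0))

/-- The pairing of `f x_i` with `w` is `1 - nc` times the `x_i`-coefficient of `∇_f w`. Of the two
factors `c - 1/n`, one is therefore left for that coefficient, and `eq_zero_of_linear_parts` applies
at `c = 1/n`. -/
theorem map_spec_eq_zero_of_dvd {d : ℕ} {w : MvPolynomial (Fin n) ℂ[X]}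
    (hw : w.IsHomogeneous (d + 1)) (hs : dSum w = 0)
    (h : ∀ f, unif n ^ 2 ∣ dForm Polynomial.X f w) : map (spec n) w = 0 := by
  refine eq_zero_of_linear_parts (hw.map _) fun f i => ?_
  have hn : n ≠ 0 := i.pos.ne'
  have h1 := h (map Polynomial.C f * X i)
  rw [dForm_mul_left, dForm, dPoly_comm_apply, dPoly_X, constantCoeff_dOp, one_sub_eq hn, sq,
    mul_assoc, mul_left_comm, mul_dvd_mul_iff_left unif_ne_zero] at h1
  · have h2 : unif n ∣ coeff (Finsupp.single i 1) (dPoly Polynomial.X (map Polynomial.C f) w) := by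
      refine (IsUnit.dvd_mul_left ?_).mp h1
      rw [Polynomial.isUnit_C, isUnit_iff_ne_zero]
      exact neg_ne_zero.mpr (by exact_mod_cast hn)
    rw [← spec_eq_zero_iff, ← coeff_map, map_dPoly, spec_X, map_spec_map_C] at h2
    exact h2
  · rw [dSum_dPoly, hs, map_zero]

/-- A translation invariant polynomial in the elementary symmetric polynomials of degree less
than `k` whose pairings with all such polynomials vanish to the second order at `c = 1/n`
vanishes at `c = 1/n`. -/
theorem map_spec_eq_zero_of_lowVars {k : ℕ} (hk : 2 ≤ k) (hkn : k ≤ n)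
    {Q : MvPolynomial (Fin n) ℂ[X]} (hQ : Q ∈ lowVars ℂ[X] n k)
    (hhom : (esHom ℂ[X] n Q).IsHomogeneous k) (hs : dSum (esHom ℂ[X] n Q) = 0)
    (h : ∀ F ∈ lowVars ℂ[X] n k,
      unif n ^ 2 ∣ dForm Polynomial.X (esHom ℂ[X] n F) (esHom ℂ[X] n Q)) :
    map (spec n) Q = 0 := by
  set w := esHom ℂ[X] n Q with hw
  suffices hmain : map (spec n) w = 0 by
    rw [hw, map_esHom] at hmain
    exact esHom_injective (hmain.trans (map_zero _).symm)
  refine map_spec_eq_zero_of_dvd (d := k - 1) (by rwa [Nat.sub_add_cancel (by omega)]) hs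
    fun f => Ideal.mem_span_singleton.mp ?_
  refine dForm_mem_of_lowVars _ _ k (esHom_isSymmetric Q)
    (fun F hF => Ideal.mem_span_singleton.mpr (h F hF)) (fun i hi F => ?_) f
  rw [Ideal.mem_span_singleton]
  -- Generators of degree above `k` act by zero. For `e_k` itself, `∇_{e_k} w` is a constant, namely
  -- the pairing of `e_k` with `w`.
  rcases Nat.lt_or_eq_of_le hi with hi | hi
  · rw [dPoly_eq_zero_of_lt _ hi (esymm_isHomogeneous _ _) hhom, dForm_zero_right]
    exact dvd_zero _
  · have h0 : (dPoly Polynomial.X (esymm (Fin n) ℂ[X] (i + 1)) w).IsHomogeneous 0 :=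
      dPoly_isHomogeneous _ (esymm_isHomogeneous _ _) (by rwa [← hi, zero_add])
    rw [eq_C_of_isHomogeneous_zero h0, ← mul_one (C _), dForm_C_mul_right]
    refine dvd_mul_of_dvd_left ?_ _
    change unif n ^ 2 ∣ dForm _ _ _
    obtain ⟨F, hF, hE⟩ := exists_centeredEsymm_eq hk hkn
    -- Replace `e_k` by `ē_k` minus a multiple of `e_1`. The multiple pairs to zero with `w`, and by
    -- symmetry of the form the pairing with `ē_k` is divisible by the square.
    have h1 : esymm (Fin n) ℂ[X] (i + 1) = map Polynomial.C (centeredEsymm n k) -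
        esHom ℂ[X] n (map Polynomial.C F) * esymm (Fin n) ℂ[X] 1 := by
      rw [hE, ← hi, map_add, map_mul, map_esymm, map_esymm, map_esHom]
      ring
    rw [h1, dForm_sub_left, dForm_mul_left, dPoly_esymm_one, hs, dForm_zero_right, sub_zero,
      dForm_comm_of_isHomogeneous _ k
        ((centeredEsymm_isHomogeneous k).map _) hhom]
    exact unif_sq_dvd_dForm_centeredEsymm hk hkn hQ

end Specialization

/-! ### Nondegeneracy for generic `c`, by descent at `c = 0` and at `c = 1/n`. -/

section Generic

open scoped Polynomial

variable {n : ℕ}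

/-- The inclusion `ℂ[c] ⊆ ℂ(c)`. -/
noncomputable def toKc : ℂ[X] →+* Kc := algebraMap ℂ[X] (RatFunc ℂ)

theorem toKc_injective : Function.Injective toKc := RatFunc.algebraMap_injective ℂ

theorem toKc_X : toKc Polynomial.X = (RatFunc.X : Kc) := RatFunc.algebraMap_X

theorem toKc_C (a : ℂ) : toKc (Polynomial.C a) = RatFunc.C a := RatFunc.algebraMap_C a

theorem map_toKc_injective : Function.Injective (map (σ := Fin n) toKc) :=
  map_injective _ toKc_injective

theorem map_toKc_map_C (f : SV n) : map toKc (map Polynomial.C f) = toSc f := by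
  rw [map_map, toSc]
  congr 1

theorem exists_clear_denominators (Q : ScV n) :
    ∃ h : ℂ[X], h ≠ 0 ∧ ∃ P : MvPolynomial (Fin n) ℂ[X], map toKc P = C (toKc h) * Q := by
  induction Q using MvPolynomial.induction_on with
  | C a =>
    refine ⟨a.denom, a.denom_ne_zero, C a.num, ?_⟩
    have h0 : toKc a.denom ≠ 0 := (map_ne_zero_iff _ toKc_injective).mpr a.denom_ne_zero
    have h1 : toKc a.num / toKc a.denom = a := RatFunc.num_div_denom a
    rw [map_C, ← map_mul, ← (div_eq_iff h0).mp h1 |>.trans (mul_comm _ _)]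
  | add p q hp hq =>
    obtain ⟨h, hh, P, hP⟩ := hp
    obtain ⟨h', hh', P', hP'⟩ := hq
    refine ⟨h * h', mul_ne_zero hh hh', C h' * P + C h * P', ?_⟩
    rw [map_add, map_mul, map_mul, hP, hP', map_C, map_C, map_mul, map_mul]
    ring
  | mul_X p i hp =>
    obtain ⟨h, hh, P, hP⟩ := hp
    exact ⟨h, hh, P * X i, by rw [map_mul, hP, map_X, mul_assoc]⟩

/-- Infinite descent: a polynomial that stays in a class when divided by `X - a` is zero. -/
theorem eq_zero_of_descent (a : ℂ) (p : MvPolynomial (Fin n) ℂ[X] → Prop)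
    (h : ∀ w, p w → ∃ w', p w' ∧ w = C (Polynomial.X - Polynomial.C a) * w')
    {w : MvPolynomial (Fin n) ℂ[X]} (hw : p w) : w = 0 := by
  have key : ∀ N : ℕ, ∀ w, p w → C ((Polynomial.X - Polynomial.C a) ^ N) ∣ w := by
    intro N
    induction N with
    | zero => intro w _; simp
    | succ N ih =>
      intro w hw
      obtain ⟨w', hw', rfl⟩ := h w hw
      rw [pow_succ', map_mul]
      exact mul_dvd_mul_left _ (ih w' hw')
  refine MvPolynomial.ext _ _ fun m => ?_
  rw [coeff_zero]
  by_contra hne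
  have h1 := (C_dvd_iff_dvd_coeff _ _).mp (key ((coeff m w).natDegree + 1) w hw) m
  have h2 := Polynomial.natDegree_le_of_dvd h1 hne
  rw [Polynomial.natDegree_pow, Polynomial.natDegree_X_sub_C] at h2
  omega

theorem C_mul_ne_zero_cancel {R : Type*} [CommRing R] [IsDomain R] {a : R} (ha : a ≠ 0)
    {f : MvPolynomial (Fin n) R} (h : C a * f = 0) : f = 0 :=
  (mul_eq_zero.mp h).resolve_left ((map_ne_zero_iff C (C_injective _ _)).mpr ha)

theorem isHomogeneous_of_C_mul {R : Type*} [CommRing R] [IsDomain R] {a : R} (ha : a ≠ 0) {d : ℕ}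
    {f : MvPolynomial (Fin n) R} (h : (C a * f).IsHomogeneous d) : f.IsHomogeneous d := by
  intro m hm
  refine h (d := m) ?_
  rw [coeff_C_mul]
  exact mul_ne_zero ha hm

theorem mem_lowVars_of_C_mul {R : Type*} [CommRing R] [IsDomain R] {a : R} (ha : a ≠ 0) {k : ℕ}
    {f : MvPolynomial (Fin n) R} (h : C a * f ∈ lowVars R n k) : f ∈ lowVars R n k := by
  rw [mem_lowVars_iff] at h ⊢
  refine fun m hm => h m ?_
  rw [mem_support_iff, coeff_C_mul]
  exact mul_ne_zero ha (mem_support_iff.mp hm)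

theorem dOp_C_mul {R : Type*} [CommRing R] [IsDomain R] (c a : R) (i : Fin n)
    (f : MvPolynomial (Fin n) R) : dOp c i (C a * f) = C a * dOp c i f := by
  rw [← smul_eq_C_mul, map_smul, smul_eq_C_mul]

/-- For generic `c` there are no singular polynomials of positive degree. -/
theorem eq_zero_of_generic_singular {d : ℕ} {w : ScV n} (hw : w.IsHomogeneous (d + 1))
    (h : ∀ i, dOp (RatFunc.X : Kc) i w = 0) : w = 0 := by
  obtain ⟨a, ha, P, hP⟩ := exists_clear_denominators w
  have haK : toKc a ≠ 0 := (map_ne_zero_iff _ toKc_injective).mpr ha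
  refine C_mul_ne_zero_cancel haK ?_
  rw [← hP, (map_eq_zero_iff _ map_toKc_injective)]
  refine eq_zero_of_descent 0 (fun w => w.IsHomogeneous (d + 1) ∧
    ∀ i, dOp (Polynomial.X : ℂ[X]) i w = 0) (fun w hw => ?_) ⟨?_, fun i => ?_⟩
  · obtain ⟨hhom, hs⟩ := hw
    have hX : (Polynomial.X - Polynomial.C 0 : ℂ[X]) ≠ 0 := Polynomial.X_sub_C_ne_zero _
    -- At `c = 0` the Dunkl operators are the partial derivatives, so Euler's identity kills the
    -- specialization; `w` is then divisible by `c` and the quotient is again singular.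
    have h0 : map (Polynomial.evalRingHom (0 : ℂ)) w = 0 := by
      have hE := (hhom.map (Polynomial.evalRingHom (0 : ℂ))).sum_X_mul_pderiv
      have hp : ∀ i, pderiv i (map (Polynomial.evalRingHom (0 : ℂ)) w) = 0 := by
        intro i
        have := congrArg (map (Polynomial.evalRingHom (0 : ℂ))) (hs i)
        rw [map_dOp, dOp_apply, map_zero] at this
        simpa using this
      simp only [hp, mul_zero, Finset.sum_const_zero] at hE
      exact (smul_eq_zero.mp hE.symm).resolve_left (Nat.succ_ne_zero d)
    rw [← C_dvd_iff_map_hom_eq_zero _ (Polynomial.X - Polynomial.C 0 : ℂ[X])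
      (fun r => by rw [Polynomial.dvd_iff_isRoot]; rfl)] at h0
    obtain ⟨w', rfl⟩ := h0
    refine ⟨w', ⟨isHomogeneous_of_C_mul hX hhom, fun i => C_mul_ne_zero_cancel hX ?_⟩, rfl⟩
    rw [← dOp_C_mul, hs i]
  · refine IsHomogeneous.of_map toKc_injective ?_
    rw [hP]; exact hw.C_mul _
  · refine map_toKc_injective ?_
    rw [map_dOp, toKc_X, hP, dOp_C_mul, h i, mul_zero, map_zero]

theorem eq_zero_of_dForm_eq_zero {d : ℕ} {w : ScV n} (hw : w.IsHomogeneous d)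
    (h : ∀ f, dForm (RatFunc.X : Kc) f w = 0) : w = 0 := by
  induction d generalizing w with
  | zero =>
    have := h (C 1)
    rw [dForm_C_left, one_mul] at this
    rw [eq_C_of_isHomogeneous_zero hw, this, C_0]
  | succ d ih =>
    refine eq_zero_of_generic_singular hw fun i => ih (dOp_isHomogeneous _ i hw) fun f => ?_
    rw [← dForm_X_mul_left]
    exact h _

/-- For generic `c`, symmetric polynomials of degree `k` orthogonal to the elementary symmetric
polynomials of degree less than `k` are translation invariant. -/
theorem dSum_eq_zero_of_orthogonal {k : ℕ} (hk : 2 ≤ k) (hkn : k ≤ n) {w : ScV n}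
    (hw : w.IsHomogeneous k) (hs : w.IsSymmetric)
    (h : ∀ F ∈ lowVars Kc n k, dForm (RatFunc.X : Kc) (esHom Kc n F) w = 0) : dSum w = 0 := by
  have hE : dSum w = dPoly (RatFunc.X : Kc) (esymm (Fin n) Kc 1) w := (dPoly_esymm_one _ _).symm
  have hhom : (dSum w).IsHomogeneous (k - 1) := by
    rw [hE]
    refine dPoly_isHomogeneous _ (esymm_isHomogeneous _ _) ?_
    rwa [Nat.sub_add_cancel (by omega)]
  refine eq_zero_of_dForm_eq_zero hhom fun f => (Submodule.mem_bot Kc).mp ?_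
  refine dForm_mem_of_lowVars _ ⊥ k ?_ (fun F hF => ?_) (fun i hi F => ?_) f
  · rw [hE]
    exact dPoly_isSymmetric _ (esymm_isSymmetric _ _ _) hs
  -- The variable of index 0 stands for `e_1`, a low generator because `k ≥ 2`; it moves across the
  -- form as `∇_{e_1}`.
  · have h1 := h (F * X ⟨0, by omega⟩) (Subalgebra.mul_mem _ hF (X_mem_lowVars (by simp; omega)))
    rw [map_mul, dForm_mul_left, esHom_X] at h1
    rw [Submodule.mem_bot, hE]
    exact h1
  · rw [dPoly_eq_zero_of_lt _ (by omega) (esymm_isHomogeneous _ _) hhom, dForm_zero_right]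
    exact Submodule.zero_mem _

/-- The form is nondegenerate on the polynomials of degree `k` in the elementary symmetric
polynomials of degree less than `k`. -/
theorem lowVars_nondegenerate {k : ℕ} (hk : 2 ≤ k) (hkn : k ≤ n) {Q : ScV n}
    (hQ : Q ∈ lowVars Kc n k) (hhom : (esHom Kc n Q).IsHomogeneous k)
    (h : ∀ F ∈ lowVars Kc n k, dForm (RatFunc.X : Kc) (esHom Kc n F) (esHom Kc n Q) = 0) :
    Q = 0 := by
  have hsum := dSum_eq_zero_of_orthogonal hk hkn hhom (esHom_isSymmetric Q) h
  obtain ⟨a, ha, P, hP⟩ := exists_clear_denominators Q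
  have haK : toKc a ≠ 0 := (map_ne_zero_iff _ toKc_injective).mpr ha
  have hPes : map toKc (esHom ℂ[X] n P) = C (toKc a) * esHom Kc n Q := by
    rw [map_esHom, hP, map_mul, esHom_C]
  refine C_mul_ne_zero_cancel haK ?_
  rw [← hP, (map_eq_zero_iff _ map_toKc_injective)]
  refine eq_zero_of_descent ((n : ℂ)⁻¹) (fun P => P ∈ lowVars ℂ[X] n k ∧
    (esHom ℂ[X] n P).IsHomogeneous k ∧ dSum (esHom ℂ[X] n P) = 0 ∧
    ∀ F ∈ lowVars ℂ[X] n k, dForm Polynomial.X (esHom ℂ[X] n F) (esHom ℂ[X] n P) = 0)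
    (fun P hP => ?_) ⟨?_, ?_, ?_, fun F hF => ?_⟩
  · obtain ⟨h1, h2, h3, h4⟩ := hP
    have h0 := map_spec_eq_zero_of_lowVars hk hkn h1 h2 h3
      (fun F hF => by rw [h4 F hF]; exact dvd_zero _)
    obtain ⟨P', rfl⟩ := (map_spec_eq_zero_iff P).mp h0
    rw [map_mul, esHom_C] at h2 h3
    refine ⟨P', ⟨mem_lowVars_of_C_mul unif_ne_zero h1, isHomogeneous_of_C_mul unif_ne_zero h2,
      C_mul_ne_zero_cancel (unif_ne_zero (n := n)) (by rwa [← dSum_C_mul]), fun F hF => ?_⟩, rfl⟩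
    have := h4 F hF
    rw [map_mul, esHom_C, dForm_C_mul_right] at this
    exact (mul_eq_zero.mp this).resolve_left unif_ne_zero
  · refine mem_lowVars_of_map toKc_injective ?_
    rw [hP]
    exact Subalgebra.mul_mem _ (C_mem_lowVars _) hQ
  · refine IsHomogeneous.of_map toKc_injective ?_
    rw [hPes]
    exact hhom.C_mul _
  · refine map_toKc_injective ?_
    rw [map_dSum, hPes, dSum_C_mul, hsum, mul_zero, map_zero]
  · refine toKc_injective ?_
    rw [map_dForm, toKc_X, hPes, dForm_C_mul_right, map_esHom,
      h _ (map_mem_lowVars _ hF), mul_zero, map_zero]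

/-- A translation invariant polynomial over `ℂ(c)` in the low elementary symmetric polynomials,
whose pairings are regular and vanish to the second order at `c = 1/n`, is itself regular and
vanishes at `c = 1/n`. -/
theorem exists_regular_of_dvd {k : ℕ} (hk : 2 ≤ k) (hkn : k ≤ n) {Q : ScV n}
    (hQ : Q ∈ lowVars Kc n k) (hhom : (esHom Kc n Q).IsHomogeneous k)
    (hsum : dSum (esHom Kc n Q) = 0)
    (h : ∀ F ∈ lowVars ℂ[X] n k, ∃ a, dForm (RatFunc.X : Kc) (map toKc (esHom ℂ[X] n F))
      (esHom Kc n Q) = toKc (unif n ^ 2 * a)) :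
    ∃ (a : ℂ[X]) (P : MvPolynomial (Fin n) ℂ[X]), spec n a ≠ 0 ∧ map (spec n) P = 0 ∧
      map toKc P = C (toKc a) * Q := by
  obtain ⟨a, ha, P, hP⟩ := exists_clear_denominators Q
  -- If the denominator `a` vanishes at `1/n`, so does the numerator `P`; the common factor `c -
  -- 1/n` is cancelled, lowering the degree of `a`.
  induction hd : a.natDegree using Nat.strong_induction_on generalizing a P with
  | _ d ih =>
  subst hd
  have hPes : map toKc (esHom ℂ[X] n P) = C (toKc a) * esHom Kc n Q := by
    rw [map_esHom, hP, map_mul, esHom_C]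
  have h0 : map (spec n) P = 0 := by
    refine map_spec_eq_zero_of_lowVars hk hkn (mem_lowVars_of_map toKc_injective ?_)
      (IsHomogeneous.of_map toKc_injective ?_) (map_toKc_injective ?_) (fun F hF => ?_)
    · rw [hP]
      exact Subalgebra.mul_mem _ (C_mem_lowVars _) hQ
    · rw [hPes]
      exact hhom.C_mul _
    · rw [map_dSum, hPes, dSum_C_mul, hsum, mul_zero, map_zero]
    · obtain ⟨b, hb⟩ := h F hF
      refine ⟨a * b, toKc_injective ?_⟩
      rw [map_dForm, toKc_X, hPes, dForm_C_mul_right, hb, ← map_mul]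
      congr 1
      ring
  by_cases hspec : spec n a = 0
  · obtain ⟨b, rfl⟩ := (spec_eq_zero_iff a).mp hspec
    obtain ⟨P', rfl⟩ := (map_spec_eq_zero_iff P).mp h0
    have hb : b ≠ 0 := right_ne_zero_of_mul ha
    refine ih b.natDegree ?_ b hb P' ?_ rfl
    · rw [Polynomial.natDegree_mul unif_ne_zero hb, unif, Polynomial.natDegree_X_sub_C]
      omega
    · have hu : toKc (unif n) ≠ 0 := (map_ne_zero_iff _ toKc_injective).mpr unif_ne_zero
      have hC : (C (toKc (unif n)) : ScV n) ≠ 0 := (map_ne_zero_iff C (C_injective _ _)).mpr hu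
      refine mul_left_cancel₀ hC ?_
      rw [map_mul, map_C, map_mul, map_mul, mul_assoc] at hP
      exact hP
  · exact ⟨a, P, hspec, h0, hP⟩

end Generic

/-! ### Weights of monomials in generators. -/

section Weights

variable {R : Type*} [CommRing R] {n : ℕ}

theorem aeval_monomial_isHomogeneous {u : Fin n → MvPolynomial (Fin n) R}
    (hu : ∀ i, (u i).IsHomogeneous ((i : ℕ) + 1)) (m : Fin n →₀ ℕ) (a : R) :
    (aeval u (monomial m a) : MvPolynomial (Fin n) R).IsHomogeneous (weight m) := by
  rw [aeval_monomial, algebraMap_eq, Finsupp.prod_fintype _ _ (by simp)]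
  exact IsHomogeneous.C_mul (IsHomogeneous.prod _ _ _ fun i _ => (hu i).pow (m i)) a

/-- The part of a polynomial of given weight. -/
noncomputable def weightPart (d : ℕ) (Q : MvPolynomial (Fin n) R) : MvPolynomial (Fin n) R :=
  ∑ m ∈ Q.support, if weight m = d then monomial m (coeff m Q) else 0

theorem coeff_weightPart (d : ℕ) (Q : MvPolynomial (Fin n) R) (m : Fin n →₀ ℕ) :
    coeff m (weightPart d Q) = if weight m = d then coeff m Q else 0 := by
  classical
  rw [weightPart, coeff_sum]
  have : ∀ m' ∈ Q.support, coeff m (if weight m' = d then monomial m' (coeff m' Q) else 0) =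
      if m' = m then (if weight m = d then coeff m Q else 0) else 0 := by
    intro m' _
    by_cases h : m' = m
    · subst h; rw [if_pos rfl]; split_ifs <;> simp
    · split_ifs <;> simp [coeff_monomial, h]
  rw [Finset.sum_congr rfl this, Finset.sum_ite_eq' Q.support m]
  split_ifs with h1 h2 h2
  · rfl
  · rfl
  · exact (notMem_support_iff.mp h1).symm
  · rfl

theorem homogeneousComponent_aeval {u : Fin n → MvPolynomial (Fin n) R}
    (hu : ∀ i, (u i).IsHomogeneous ((i : ℕ) + 1)) (d : ℕ) (Q : MvPolynomial (Fin n) R) :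
    homogeneousComponent d (aeval u Q : MvPolynomial (Fin n) R) = aeval u (weightPart d Q) := by
  conv_lhs => rw [Q.as_sum]
  rw [weightPart, map_sum, map_sum, map_sum]
  refine Finset.sum_congr rfl fun m _ => ?_
  rw [homogeneousComponent_of_mem (aeval_monomial_isHomogeneous hu m _)]
  split_ifs with h1 h2 h2
  · rfl
  · exact absurd h1.symm h2
  · exact absurd h2.symm h1
  · rw [map_zero]

theorem esHom_monomial_isHomogeneous (m : Fin n →₀ ℕ) (a : R) :
    (esHom R n (monomial m a)).IsHomogeneous (weight m) :=
  aeval_monomial_isHomogeneous (fun _ => esymm_isHomogeneous _ _) m a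

/-- Homogeneous components of the image come from weight parts of `Q`, and algebraic independence of
the `e_i` carries the comparison back to `Q`. -/
theorem weight_eq_of_isHomogeneous_esHom {d : ℕ} {Q : MvPolynomial (Fin n) R}
    (h : (esHom R n Q).IsHomogeneous d) {m : Fin n →₀ ℕ} (hm : coeff m Q ≠ 0) : weight m = d := by
  have h1 : esHom R n (weightPart d Q) = esHom R n Q := by
    rw [← homogeneousComponent_eq_self h]
    exact (homogeneousComponent_aeval (fun _ => esymm_isHomogeneous _ _) d Q).symm
  have h2 := congrArg (coeff m) (esHom_injective h1)
  rw [coeff_weightPart] at h2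
  by_contra hne
  rw [if_neg hne] at h2
  exact hm h2.symm

theorem weight_finite (k : ℕ) : {m : Fin n →₀ ℕ | weight m = k}.Finite := by
  refine (Set.finite_Iic (Finsupp.equivFunOnFinite.symm fun _ : Fin n => k)).subset
    fun m hm => fun i => ?_
  rw [Finsupp.equivFunOnFinite_symm_apply_apply, ← (show weight m = k from hm)]
  refine le_trans ?_ (Finset.single_le_sum (f := fun i : Fin n => ((i : ℕ) + 1) * m i)
    (fun _ _ => Nat.zero_le _) (Finset.mem_univ i))
  exact Nat.le_mul_of_pos_left _ (Nat.succ_pos _)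

end Weights

/-! ### Existence of the orthogonal invariant and its limit. -/

section Existence

open scoped Polynomial

variable {n : ℕ}

/-- Existence of the elementary canonical invariant. -/
theorem exists_orthogonal {k : ℕ} (hk : 2 ≤ k) (hkn : k ≤ n) : ∃ Q ∈ lowVars Kc n k,
    (esHom Kc n Q).IsHomogeneous k ∧ ∀ F ∈ lowVars Kc n k,
      dForm (RatFunc.X : Kc) (esHom Kc n F) (esymm (Fin n) Kc k + esHom Kc n Q) = 0 := by
  let I : Set (Fin n →₀ ℕ) := {m | weight m = k ∧ ∀ i : Fin n, m i ≠ 0 → (i : ℕ) + 1 < k}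
  have hI : I.Finite := (weight_finite k).subset fun m hm => hm.1
  have : Fintype I := hI.fintype
  let q : (I → Kc) →ₗ[Kc] ScV n := Fintype.linearCombination Kc fun m : I => monomial m.1 1
  have hq : ∀ v, q v = ∑ m : I, monomial m.1 (v m) := fun v => by
    rw [Fintype.linearCombination_apply]
    simp [smul_monomial]
  have hqlow : ∀ v, q v ∈ lowVars Kc n k := fun v => by
    rw [hq]
    exact Subalgebra.sum_mem _ fun m _ => monomial_mem_lowVars m.2.2 _
  have hqhom : ∀ v, (esHom Kc n (q v)).IsHomogeneous k := fun v => by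
    rw [hq, map_sum]
    refine IsHomogeneous.sum _ _ _ fun m _ => ?_
    have := esHom_monomial_isHomogeneous (R := Kc) m.1 (v m)
    rwa [m.2.1] at this
  have hqcoeff : ∀ v (m : I), coeff m.1 (q v) = v m := fun v m => by
    classical
    rw [hq, coeff_sum, Finset.sum_eq_single m]
    · simp
    · intro m' _ hne
      rw [coeff_monomial, if_neg fun e => hne (Subtype.ext e)]
    · simp
  have horth : ∀ w : ScV n, w.IsHomogeneous k →
      (∀ m : I, dForm (RatFunc.X : Kc) (esHom Kc n (monomial m.1 1)) w = 0) →
      ∀ F ∈ lowVars Kc n k, dForm (RatFunc.X : Kc) (esHom Kc n F) w = 0 := by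
    intro w hw h F hF
    rw [F.as_sum, map_sum, dForm_sum_left]
    refine Finset.sum_eq_zero fun m hm => ?_
    by_cases hmk : weight m = k
    · have h1 : monomial m (coeff m F) = C (coeff m F) * monomial m 1 := by
        rw [C_mul_monomial, mul_one]
      rw [h1, map_mul, esHom_C, dForm_C_mul_left, h ⟨m, hmk, mem_lowVars_iff.mp hF m hm⟩, mul_zero]
    · exact dForm_eq_zero_of_ne _ hmk (esHom_monomial_isHomogeneous m _) hw
  -- The Gram operator of the form on low monomials of weight `k`. Evaluation at zero serves as the
  -- `Kc`-linear constant term. Nondegeneracy makes `T` injective, hence surjective, and the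
  -- orthogonality equations are solvable.
  let T : (I → Kc) →ₗ[Kc] (I → Kc) := LinearMap.pi fun m =>
    ((aeval (fun _ => 0) : ScV n →ₐ[Kc] Kc).toLinearMap ∘ₗ
      dPoly (RatFunc.X : Kc) (esHom Kc n (monomial m.1 1)) ∘ₗ
      (esHom Kc n).toLinearMap ∘ₗ q)
  have hT : ∀ v (m : I), T v m =
      dForm (RatFunc.X : Kc) (esHom Kc n (monomial m.1 1)) (esHom Kc n (q v)) := by
    intro v m
    change aeval (fun _ => (0 : Kc)) _ = constantCoeff _
    rw [aeval_zero']
    rfl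
  have hTinj : Function.Injective T := by
    rw [← LinearMap.ker_eq_bot, LinearMap.ker_eq_bot']
    intro v hv
    have h0 : q v = 0 := lowVars_nondegenerate hk hkn (hqlow v) (hqhom v)
      (horth _ (hqhom v) fun m => by rw [← hT, hv]; rfl)
    funext m
    rw [← hqcoeff v m, h0]
    rfl
  obtain ⟨v, hv⟩ := (LinearMap.injective_iff_surjective.mp hTinj)
    fun m => - dForm (RatFunc.X : Kc) (esHom Kc n (monomial m.1 1)) (esymm (Fin n) Kc k)
  refine ⟨q v, hqlow v, hqhom v, horth _ ((esymm_isHomogeneous _ _).add (hqhom v)) fun m => ?_⟩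
  rw [dForm_add_right, ← hT, hv]
  exact add_neg_cancel _

/-- The hypothesis says `r = a + p/h`, so the reduced denominator divides `h` and does not vanish at
`c₀`; the limit is then the value of a continuous quotient. -/
theorem eval_denom_ne_zero_and_tendsto {r : Kc} {a c₀ : ℂ} {p h : ℂ[X]} (hh : h.eval c₀ ≠ 0)
    (hp : p.eval c₀ = 0) (hr : toKc h * r = toKc (Polynomial.C a * h + p)) :
    r.denom.eval c₀ ≠ 0 ∧ Filter.Tendsto (fun z : ℂ => RatFunc.eval (RingHom.id ℂ) z r)
      (nhdsWithin c₀ {c₀}ᶜ) (nhds a) := by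
  have hd : toKc r.denom ≠ 0 := (map_ne_zero_iff _ toKc_injective).mpr r.denom_ne_zero
  have hh0 : toKc h ≠ 0 := (map_ne_zero_iff _ toKc_injective).mpr fun e => hh (by simp [e])
  have h1 : r = toKc (Polynomial.C a * h + p) / toKc h := by
    rw [eq_div_iff hh0, mul_comm, hr]
  have h2 : r.denom ∣ h := by
    rw [h1]; exact RatFunc.denom_div_dvd _ _
  have h3 : r.denom.eval c₀ ≠ 0 := by
    obtain ⟨g, hg⟩ := h2
    rw [hg, Polynomial.eval_mul] at hh
    exact left_ne_zero_of_mul hh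
  refine ⟨h3, ?_⟩
  have h4 : h * r.num = (Polynomial.C a * h + p) * r.denom := by
    refine toKc_injective ?_
    have h5 : toKc r.num / toKc r.denom = r := RatFunc.num_div_denom r
    rw [map_mul, map_mul, ← hr, (div_eq_iff hd).mp h5]
    ring
  have h6 : a = r.num.eval c₀ / r.denom.eval c₀ := by
    have := congrArg (Polynomial.eval c₀) h4
    simp only [Polynomial.eval_mul, Polynomial.eval_add, Polynomial.eval_C, hp, add_zero] at this
    rw [eq_div_iff h3]
    refine mul_left_cancel₀ hh ?_
    linear_combination -this
  have h7 : Filter.Tendsto (fun z : ℂ => r.num.eval z / r.denom.eval z) (nhds c₀) (nhds a) := by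
    rw [h6]
    exact (r.num.continuous.tendsto c₀).div (r.denom.continuous.tendsto c₀) h3
  exact h7.mono_left nhdsWithin_le_nhds

/-- A polynomial `e_k + Q(e_1, …, e_{k-1})` orthogonal to the polynomials in `e_1, …, e_{k-1}`
tends to the centred elementary symmetric polynomial as `c` tends to `1/n`. -/
theorem noPoleAt_and_hasLimitAt {k : ℕ} (hk : 2 ≤ k) (hkn : k ≤ n) {Q : ScV n}
    (hQ : Q ∈ lowVars Kc n k) (hhom : (esHom Kc n Q).IsHomogeneous k)
    (h : ∀ F ∈ lowVars Kc n k,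
      dForm (RatFunc.X : Kc) (esHom Kc n F) (esymm (Fin n) Kc k + esHom Kc n Q) = 0) :
    NoPoleAt (esymm (Fin n) Kc k + esHom Kc n Q) ((n : ℂ)⁻¹) ∧
      HasLimitAt (esymm (Fin n) Kc k + esHom Kc n Q) ((n : ℂ)⁻¹) (centeredEsymm n k) := by
  set b := esymm (Fin n) Kc k + esHom Kc n Q with hb
  have hbhom : b.IsHomogeneous k := (esymm_isHomogeneous _ _).add hhom
  have hbsum : dSum b = 0 := dSum_eq_zero_of_orthogonal hk hkn hbhom
    ((esymm_isSymmetric _ _ _).add (esHom_isSymmetric Q)) h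
  have hcsum : dSum (toSc (centeredEsymm n k)) = 0 := by
    rw [toSc, ← map_dSum, dSum_centeredEsymm, map_zero]
  obtain ⟨D, hD, hDeq⟩ := exists_centeredEsymm_eq hk hkn
  have hP : esHom Kc n (Q - X ⟨0, by omega⟩ * map RatFunc.C D) = b - toSc (centeredEsymm n k) := by
    rw [toSc, hDeq, map_add, map_mul, map_esymm, map_esymm, map_esHom, map_sub, map_mul, esHom_X, hb]
    simp only [zero_add]
    ring
  -- The difference `b - ē_k` pairs with `A` as `-ē_k` does, since `b` is orthogonal to `A`.
  obtain ⟨a, P, ha, hP0, hPa⟩ := exists_regular_of_dvd hk hkn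
    (Q := Q - X ⟨0, by omega⟩ * map RatFunc.C D)
    (Subalgebra.sub_mem _ hQ (Subalgebra.mul_mem _ (X_mem_lowVars (by simp; omega))
      (map_mem_lowVars _ hD)))
    (by rw [hP]; exact hbhom.sub ((centeredEsymm_isHomogeneous k).map _))
    (by rw [hP, map_sub, hbsum, hcsum, sub_zero])
    (fun F hF => by
      obtain ⟨g, hg⟩ := unif_sq_dvd_dForm_centeredEsymm hk hkn hF
      refine ⟨-g, ?_⟩
      rw [hP, dForm_sub_right, map_esHom, h _ (map_mem_lowVars _ hF), ← map_toKc_map_C,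
        ← map_esHom, ← toKc_X, ← map_dForm, hg, zero_sub, ← map_neg]
      congr 1
      ring)
  have hcoeff : ∀ m, toKc a * coeff m b = toKc (Polynomial.C (coeff m (centeredEsymm n k)) * a +
      coeff m (esHom ℂ[X] n P)) := by
    intro m
    have h1 : C (toKc a) * (b - toSc (centeredEsymm n k)) = map toKc (esHom ℂ[X] n P) := by
      rw [map_esHom, hPa, map_mul, esHom_C, hP]
    have h2 := congrArg (coeff m) h1
    rw [coeff_C_mul, coeff_sub, coeff_map, toSc, coeff_map, ← toKc_C] at h2
    rw [map_add, map_mul]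
    linear_combination h2
  have hzero : ∀ m, (coeff m (esHom ℂ[X] n P)).eval ((n : ℂ)⁻¹) = 0 := by
    intro m
    have h1 : map (spec n) (esHom ℂ[X] n P) = 0 := by rw [map_esHom, hP0, map_zero]
    have h2 := congrArg (coeff m) h1
    rw [coeff_map] at h2
    exact h2
  exact ⟨fun m => (eval_denom_ne_zero_and_tendsto ha (hzero m) (hcoeff m)).1,
    fun m => (eval_denom_ne_zero_and_tendsto ha (hzero m) (hcoeff m)).2⟩

end Existence

/-! ### Independence of the lower span from the choice of generators. -/

section Generators

variable {n : ℕ}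

/-- The exponent of the `k`-th generator. -/
def unitExp (n k : ℕ) : Fin n → ℕ := fun i => if (i : ℕ) + 1 = k then 1 else 0

/-- The order imposes no bound on the degree, so the lower span is the whole algebra generated by
the first `k - 1` generators. -/
theorem invLexLT_unitExp_iff {k : ℕ} (hk : 1 ≤ k) (hkn : k ≤ n) (a : Fin n → ℕ) :
    InvLexLT a (unitExp n k) ↔ ∀ i, a i ≠ 0 → (i : ℕ) + 1 < k := by
  constructor
  · rintro ⟨i, hi, hgt⟩ j hj
    simp only [unitExp] at hi hgt
    have hik : (i : ℕ) + 1 = k := by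
      by_contra h
      rw [if_neg h] at hi
      omega
    rw [if_pos hik] at hi
    by_contra hjk
    rcases Nat.lt_trichotomy j i with h | h | h
    · omega
    · rw [Fin.ext h] at hj; omega
    · have := hgt j h
      rw [if_neg (by omega)] at this
      exact hj this
  · intro h
    refine ⟨⟨k - 1, by omega⟩, ?_, fun j hj => ?_⟩
    · have h0 : a ⟨k - 1, by omega⟩ = 0 := by
        by_contra hne
        have := h _ hne
        simp only at this
        omega
      rw [h0, unitExp, if_pos (by simp only; omega)]
      exact one_pos
    · have hj' : k - 1 < (j : ℕ) := hj
      rw [unitExp, if_neg (by omega)]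
      by_contra hne
      have := h j hne
      omega

theorem weight_unitExp {k : ℕ} (hk : 1 ≤ k) (hkn : k ≤ n) : weight (unitExp n k) = k := by
  rw [weight, Finset.sum_eq_single ⟨k - 1, by omega⟩]
  · simp only [unitExp]
    rw [if_pos (by omega)]
    omega
  · intro i _ hi
    rw [unitExp, if_neg, mul_zero]
    intro h
    exact hi (Fin.ext (by simp only; omega))
  · simp

theorem mul_le_weight (a : Fin n → ℕ) (i : Fin n) : ((i : ℕ) + 1) * a i ≤ weight a :=
  Finset.single_le_sum (f := fun i : Fin n => ((i : ℕ) + 1) * a i)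
    (fun _ _ => Nat.zero_le _) (Finset.mem_univ i)

theorem add_mul_le_weight (a : Fin n → ℕ) {i j : Fin n} (hij : i ≠ j) :
    ((i : ℕ) + 1) * a i + ((j : ℕ) + 1) * a j ≤ weight a := by
  classical
  rw [weight, ← Finset.sum_pair (f := fun i : Fin n => ((i : ℕ) + 1) * a i) hij]
  exact Finset.sum_le_sum_of_subset (Finset.subset_univ _)

/-- An exponent of weight `k` is either the `k`-th unit vector or has support below `k`. -/
theorem eq_unitExp_or_lt {k : ℕ} (hk : 1 ≤ k) (hkn : k ≤ n) {a : Fin n → ℕ} (ha : weight a = k) :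
    a = unitExp n k ∨ ∀ i, a i ≠ 0 → (i : ℕ) + 1 < k := by
  by_cases h : a ⟨k - 1, by omega⟩ = 0
  · right
    intro i hi
    have h1 := mul_le_weight a i
    have h2 : (i : ℕ) + 1 ≤ ((i : ℕ) + 1) * a i := Nat.le_mul_of_pos_right _ (by omega)
    have h3 : (i : ℕ) ≠ k - 1 := fun e => hi (by rw [← h]; congr 1; exact Fin.ext e)
    omega
  · left
    funext i
    by_cases hi : i = ⟨k - 1, by omega⟩
    · subst hi
      have h1 := mul_le_weight a ⟨k - 1, by omega⟩
      simp only at h1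
      rw [ha, Nat.sub_add_cancel hk] at h1
      rw [unitExp, if_pos (by simp only; omega)]
      have := Nat.le_of_mul_le_mul_left (h1.trans_eq (mul_one k).symm) (by omega)
      omega
    · have h1 := add_mul_le_weight a hi
      simp only at h1
      rw [ha, Nat.sub_add_cancel hk] at h1
      have h2 : k ≤ k * a ⟨k - 1, by omega⟩ := Nat.le_mul_of_pos_right _ (by omega)
      have h3 : ((i : ℕ) + 1) * a i = 0 := by omega
      have h4 : a i = 0 := (Nat.mul_eq_zero.mp h3).resolve_left (Nat.succ_ne_zero _)
      rw [h4, unitExp, if_neg]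
      intro e
      exact hi (Fin.ext (by simp only; omega))

theorem eq_unitExp_of_greatest {k : ℕ} (hk : 1 ≤ k) (hkn : k ≤ n) {a : Fin n → ℕ}
    (ha : weight a = k) (h : ∀ a', weight a' = k → a' ≠ a → InvLexLT a' a) : a = unitExp n k := by
  rcases eq_unitExp_or_lt hk hkn ha with h' | h'
  · exact h'
  by_contra hne
  obtain ⟨i, hi, hgt⟩ := h _ (weight_unitExp hk hkn) (Ne.symm hne)
  have h1 : a i ≠ 0 := by omega
  have h2 := h' i h1
  have h3 := hgt ⟨k - 1, by omega⟩ (show (i : ℕ) < k - 1 by omega)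
  rw [unitExp, if_pos (by simp only; omega)] at h3
  have h4 := h' ⟨k - 1, by omega⟩ (by omega)
  simp only at h4
  omega

theorem invLexLT_of_weight_eq {k : ℕ} (hk : 1 ≤ k) (hkn : k ≤ n) {a : Fin n → ℕ}
    (ha : weight a = k) (hne : a ≠ unitExp n k) : InvLexLT a (unitExp n k) :=
  (invLexLT_unitExp_iff hk hkn a).mpr ((eq_unitExp_or_lt hk hkn ha).resolve_left hne)

theorem prod_pow_unitExp {M : Type*} [CommMonoid M] {k : ℕ} (i : Fin n) (hi : (i : ℕ) + 1 = k)
    (u : Fin n → M) : ∏ j, u j ^ unitExp n k j = u i := by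
  rw [Finset.prod_eq_single i]
  · rw [unitExp, if_pos hi, pow_one]
  · intro j _ hj
    rw [unitExp, if_neg, pow_zero]
    intro e
    exact hj (Fin.ext (by omega))
  · simp

theorem aeval_monomial_eq (u : Fin n → SV n) (m : Fin n →₀ ℕ) (a : ℂ) :
    aeval u (monomial m a) = C a * ∏ i, u i ^ m i := by
  rw [aeval_monomial, algebraMap_eq, Finsupp.prod_fintype _ _ (by simp)]

/-- A homogeneous element of degree `j + 1` of the algebra generated by `u` is a multiple of `u_j`
up to a polynomial in the previous generators. -/
theorem exists_eq_add_of_isHomogeneous {u : Fin n → SV n}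
    (hu : ∀ i, (u i).IsHomogeneous ((i : ℕ) + 1)) {f : SV n} (j : Fin n)
    (hf : f.IsHomogeneous ((j : ℕ) + 1)) (hmem : f ∈ Algebra.adjoin ℂ (Set.range u)) :
    ∃ a : ℂ, ∃ q ∈ (lowVars ℂ n (j + 1)).map (aeval u), f = C a * u j + q := by
  rw [Algebra.adjoin_range_eq_range_aeval] at hmem
  obtain ⟨Q, rfl⟩ := hmem
  change (aeval u Q : SV n).IsHomogeneous _ at hf
  change ∃ a : ℂ, ∃ q ∈ _, aeval u Q = _
  have h1 : (aeval u Q : SV n) = aeval u (weightPart ((j : ℕ) + 1) Q) := by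
    rw [← homogeneousComponent_aeval hu, homogeneousComponent_eq_self hf]
  rw [h1, weightPart, map_sum]
  refine Finset.sum_induction _
    (fun f => ∃ a : ℂ, ∃ q ∈ (lowVars ℂ n (j + 1)).map (aeval u), f = C a * u j + q) ?_ ?_ ?_
  · rintro _ _ ⟨a, q, hq, rfl⟩ ⟨b, q', hq', rfl⟩
    exact ⟨a + b, q + q', Subalgebra.add_mem _ hq hq', by rw [map_add]; ring⟩
  · exact ⟨0, 0, Subalgebra.zero_mem _, by simp⟩
  · intro m _
    split_ifs with hm
    · rcases eq_unitExp_or_lt (Nat.succ_pos _) j.2 hm with h | h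
      · refine ⟨coeff m Q, 0, Subalgebra.zero_mem _, ?_⟩
        rw [aeval_monomial_eq, h, prod_pow_unitExp j rfl, add_zero]
      · exact ⟨0, _, ⟨_, monomial_mem_lowVars h (coeff m Q), rfl⟩, by rw [C_0, zero_mul, zero_add]; rfl⟩
    · exact ⟨0, 0, Subalgebra.zero_mem _, by simp⟩

theorem map_lowVars_eq_adjoin (u : Fin n → SV n) (k : ℕ) :
    (lowVars ℂ n k).map (aeval u) = Algebra.adjoin ℂ (u '' {i | (i : ℕ) + 1 < k}) := by
  rw [lowVars, supported_eq_adjoin_X, AlgHom.map_adjoin, ← Set.image_comp]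
  congr 2
  funext i
  simp

/-- For degree reasons `v_i` is a multiple of `u_i` plus a polynomial in earlier `u_l`: a change of
generators is triangular. -/
theorem map_lowVars_le {u v : Fin n → SV n} (hu : ∀ i, (u i).IsHomogeneous ((i : ℕ) + 1))
    (hv : ∀ i, (v i).IsHomogeneous ((i : ℕ) + 1))
    (hvu : ∀ i, v i ∈ Algebra.adjoin ℂ (Set.range u)) (k : ℕ) :
    (lowVars ℂ n k).map (aeval v) ≤ (lowVars ℂ n k).map (aeval u) := by
  rw [map_lowVars_eq_adjoin v, Algebra.adjoin_le_iff]
  rintro _ ⟨i, hi, rfl⟩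
  have hik : (i : ℕ) + 1 < k := hi
  obtain ⟨a, q, ⟨Q, hQ, hq⟩, h⟩ := exists_eq_add_of_isHomogeneous hu i (hv i) (hvu i)
  rw [h]
  refine Subalgebra.add_mem _ (Subalgebra.mul_mem _ (Subalgebra.algebraMap_mem _ a)
    ⟨X i, X_mem_lowVars hik, by simp⟩) ⟨Q, ?_, hq⟩
  change Q ∈ lowVars ℂ n _ at hQ
  change Q ∈ lowVars ℂ n _
  rw [mem_lowVars_iff] at hQ ⊢
  exact fun m hm l hl => (hQ m hm l hl).trans hik

theorem isHomogeneousGenerators_elemSymm : IsHomogeneousGenerators (elemSymm n) where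
  homogeneous i := esymm_isHomogeneous ℂ _
  generates := by
    rw [Algebra.adjoin_range_eq_range_aeval]
    ext f
    rw [mem_symmetricSubalgebra]
    constructor
    · rintro ⟨Q, rfl⟩
      exact esHom_isSymmetric Q
    · intro hf
      obtain ⟨Q, hQ⟩ := exists_esHom_eq hf
      exact ⟨Q, hQ⟩

theorem IsHomogeneousGenerators.mem_adjoin {u v : Fin n → SV n} (hu : IsHomogeneousGenerators u)
    (hv : IsHomogeneousGenerators v) (i : Fin n) : v i ∈ Algebra.adjoin ℂ (Set.range u) := by
  rw [hu.generates, ← hv.generates]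
  exact Algebra.subset_adjoin ⟨i, rfl⟩

/-- Every generator agrees up to a non-zero scalar with the elementary symmetric polynomial of the
same degree, modulo lower generators. -/
theorem IsHomogeneousGenerators.esymm_eq {u : Fin n → SV n} (hu : IsHomogeneousGenerators u)
    (j : Fin n) : ∃ a : ℂ, a ≠ 0 ∧ ∃ q ∈ (lowVars ℂ n (j + 1)).map (aeval u),
      elemSymm n j = C a * u j + q := by
  have he := isHomogeneousGenerators_elemSymm (n := n)
  obtain ⟨a, q, hq, h⟩ := exists_eq_add_of_isHomogeneous hu.homogeneous j (he.homogeneous j)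
    (hu.mem_adjoin he j)
  refine ⟨a, ?_, q, hq, h⟩
  -- If the scalar were zero, an elementary symmetric polynomial would be a polynomial in the
  -- earlier ones, against algebraic independence.
  rintro rfl
  obtain ⟨Q, hQ, hQ'⟩ := map_lowVars_le he.homogeneous hu.homogeneous (he.mem_adjoin hu) _ hq
  have h1 : esHom ℂ n Q = esHom ℂ n (X j) := by
    rw [esHom_X]
    rw [C_0, zero_mul, zero_add, ← hQ'] at h
    exact h.symm
  rw [esHom_injective h1] at hQ
  have := X_mem_supported.mp hQ
  simp at this

theorem toSc_add (f g : SV n) : toSc (f + g) = toSc f + toSc g := map_add _ _ _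

theorem toSc_mul (f g : SV n) : toSc (f * g) = toSc f * toSc g := map_mul _ _ _

theorem toSc_C (a : ℂ) : toSc (C a : SV n) = C (RatFunc.C a) := map_C _ _

theorem toSc_mem_lowerSpan {k : ℕ} (hk : 1 ≤ k) (hkn : k ≤ n) {u : Fin n → SV n} {f : SV n}
    (hf : f ∈ (lowVars ℂ n k).map (aeval u)) : toSc f ∈ lowerSpan u (unitExp n k) := by
  obtain ⟨Q, hQ, rfl⟩ := hf
  have hQ' := mem_lowVars_iff.mp hQ
  change toSc (aeval u Q) ∈ _
  rw [Q.as_sum, map_sum, toSc, map_sum]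
  refine Submodule.sum_mem _ fun m hm => ?_
  rw [aeval_monomial_eq, map_mul, map_C, ← smul_eq_C_mul]
  exact Submodule.smul_mem _ _ (Submodule.subset_span
    ⟨m, (invLexLT_unitExp_iff hk hkn m).mpr (hQ' m hm), rfl⟩)

theorem uPow_eq_toSc {k : ℕ} (hk : 1 ≤ k) (hkn : k ≤ n) (u : Fin n → SV n) {a : Fin n → ℕ}
    (ha : InvLexLT a (unitExp n k)) :
    ∃ f ∈ (lowVars ℂ n k).map (aeval u), uPow u a = toSc f := by
  refine ⟨∏ i, u i ^ a i, ⟨monomial (Finsupp.equivFunOnFinite.symm a) 1,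
    monomial_mem_lowVars ((invLexLT_unitExp_iff hk hkn a).mp ha) _, ?_⟩, rfl⟩
  change aeval u _ = _
  rw [aeval_monomial_eq, C_1, one_mul]
  rfl

theorem lowerSpan_le {k : ℕ} (hk : 1 ≤ k) (hkn : k ≤ n) {u v : Fin n → SV n}
    (hu : IsHomogeneousGenerators u) (hv : IsHomogeneousGenerators v) :
    lowerSpan v (unitExp n k) ≤ lowerSpan u (unitExp n k) := by
  rw [lowerSpan, Submodule.span_le]
  rintro _ ⟨a, ha, rfl⟩
  obtain ⟨f, hf, h⟩ := uPow_eq_toSc hk hkn v ha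
  rw [h]
  exact toSc_mem_lowerSpan hk hkn
    (map_lowVars_le hu.homogeneous hv.homogeneous (hu.mem_adjoin hv) k hf)

theorem toSc_esHom (Q : SV n) : toSc (esHom ℂ n Q) = esHom Kc n (map RatFunc.C Q) :=
  map_esHom _ _

theorem mem_lowerSpan_elemSymm {k : ℕ} (hk : 1 ≤ k) (hkn : k ≤ n) {x : ScV n} :
    x ∈ lowerSpan (elemSymm n) (unitExp n k) ↔ ∃ Q ∈ lowVars Kc n k, esHom Kc n Q = x := by
  constructor
  · intro hx
    induction hx using Submodule.span_induction with
    | zero => exact ⟨0, Subalgebra.zero_mem _, map_zero _⟩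
    | add x y _ _ hx hy =>
      obtain ⟨Q, hQ, rfl⟩ := hx
      obtain ⟨Q', hQ', rfl⟩ := hy
      exact ⟨Q + Q', Subalgebra.add_mem _ hQ hQ', map_add _ _ _⟩
    | smul a x _ hx =>
      obtain ⟨Q, hQ, rfl⟩ := hx
      exact ⟨a • Q, Subalgebra.smul_mem _ hQ a, map_smul _ _ _⟩
    | mem x hx =>
      obtain ⟨a, ha, rfl⟩ := hx
      obtain ⟨f, ⟨Q, hQ, rfl⟩, h⟩ := uPow_eq_toSc hk hkn (elemSymm n) ha
      rw [h]
      exact ⟨map RatFunc.C Q, map_mem_lowVars _ hQ, (toSc_esHom Q).symm⟩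
  · rintro ⟨Q, hQ, rfl⟩
    have hQ' := mem_lowVars_iff.mp hQ
    rw [Q.as_sum, map_sum]
    refine Submodule.sum_mem _ fun m hm => ?_
    have h1 : monomial m (coeff m Q) = coeff m Q • map RatFunc.C (monomial m (1 : ℂ)) := by
      rw [map_monomial, map_one, smul_monomial, smul_eq_mul, mul_one]
    rw [h1, map_smul, ← toSc_esHom]
    exact Submodule.smul_mem _ _ (toSc_mem_lowerSpan hk hkn
      ⟨_, monomial_mem_lowVars (hQ' m hm) _, rfl⟩)

end Generators

/-! ### Identification with the canonical invariants of the definition. -/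

section Canonical

variable {n : ℕ}

/-- In the sum over pairs `a < b` only those containing `i` survive; antisymmetry of the divided
difference puts `i` first in each of them. -/
theorem dunkl_single (i : Fin n) : dunkl (Pi.single i (1 : Kc)) = dOp (RatFunc.X : Kc) i := by
  refine LinearMap.ext fun f => ?_
  have h1 : ∑ l, (Pi.single i (1 : Kc) : Fin n → Kc) l • pderiv l f = pderiv i f := by
    rw [Finset.sum_eq_single i]
    · simp
    · intro l _ hl; simp [hl]
    · simp
  have h2 : ∑ a, ∑ b, (if a < b then ((Pi.single i (1 : Kc) : Fin n → Kc) a -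
      (Pi.single i (1 : Kc) : Fin n → Kc) b) • divDiff a b f else 0) = ∑ j, divDiff i j f := by
    have h3 : ∀ a b : Fin n, (if a < b then ((Pi.single i (1 : Kc) : Fin n → Kc) a -
        (Pi.single i (1 : Kc) : Fin n → Kc) b) • divDiff a b f else 0) =
        (if a = i then if a < b then divDiff i b f else 0 else 0) +
        (if b = i then if a < b then divDiff i a f else 0 else 0) := by
      intro a b
      by_cases hab : a < b
      · by_cases ha : a = i
        · subst ha
          simp [hab, hab.ne']
        · by_cases hb : b = i
          · subst hb
            simp [hab, hab.ne, divDiff_symm a b]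
          · simp [ha, hb]
      · simp [hab]
    simp only [h3, Finset.sum_add_distrib]
    have h4 : (∑ a, ∑ b, if a = i then if a < b then divDiff i b f else 0 else 0) =
        ∑ b, if i < b then divDiff i b f else 0 := by
      rw [Finset.sum_comm]
      refine Finset.sum_congr rfl fun b _ => ?_
      rw [Finset.sum_ite_eq' Finset.univ i]
      simp
    have h5 : (∑ a, ∑ b, if b = i then if a < b then divDiff i a f else 0 else 0) =
        ∑ a, if a < i then divDiff i a f else 0 := by
      refine Finset.sum_congr rfl fun a _ => ?_
      rw [Finset.sum_ite_eq' Finset.univ i]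
      simp
    rw [h4, h5, ← Finset.sum_add_distrib]
    refine Finset.sum_congr rfl fun j _ => ?_
    rcases lt_trichotomy i j with h | h | h
    · simp [h, h.not_gt]
    · subst h; simp [divDiff_self]
    · simp [h, h.not_gt]
  rw [dOp_apply, ← smul_eq_C_mul, ← h2, ← h1]
  simp only [dunkl, LinearMap.sub_apply, LinearMap.sum_apply, LinearMap.smul_apply]
  congr 2
  refine Finset.sum_congr rfl fun a _ => Finset.sum_congr rfl fun b _ => ?_
  split_ifs <;> rfl

theorem dunklPoly_eq (p : ScV n) : dunklPoly p = dPoly (RatFunc.X : Kc) p := by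
  conv_rhs => rw [p.as_sum, map_sum]
  refine Finset.sum_congr rfl fun m _ => ?_
  rw [dPoly_monomial]
  simp only [dunkl_single]

theorem dunklForm_eq (f g : ScV n) : dunklForm f g = dForm (RatFunc.X : Kc) f g := by
  rw [dunklForm, dunklPoly_eq, dForm]

/-- The polynomials `e_k + Q(e_1, …, e_{k-1})` orthogonal to the polynomials in
`e_1, …, e_{k-1}` are the elementary canonical invariants. -/
theorem isElementaryCanonical_iff {k : ℕ} (hk : 2 ≤ k) (hkn : k ≤ n) {Q : ScV n}
    (hQ : Q ∈ lowVars Kc n k) (hhom : (esHom Kc n Q).IsHomogeneous k)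
    (h : ∀ F ∈ lowVars Kc n k,
      dForm (RatFunc.X : Kc) (esHom Kc n F) (esymm (Fin n) Kc k + esHom Kc n Q) = 0) (x : ScV n) :
    IsElementaryCanonical n k x ↔ ∃ lam : ℂ, lam ≠ 0 ∧
      x = C (RatFunc.C lam) * (esymm (Fin n) Kc k + esHom Kc n Q) := by
  have hk1 : 1 ≤ k := by omega
  set b := esymm (Fin n) Kc k + esHom Kc n Q with hb
  have hbhom : b.IsHomogeneous k := (esymm_isHomogeneous _ _).add hhom
  have he := isHomogeneousGenerators_elemSymm (n := n)
  let j : Fin n := ⟨k - 1, by omega⟩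
  have hj : (j : ℕ) + 1 = k := Nat.sub_add_cancel hk1
  have huPow : ∀ u : Fin n → SV n, uPow u (unitExp n k) = toSc (u j) := fun u => by
    rw [uPow, prod_pow_unitExp j hj]
  have hesymm : toSc (elemSymm n j) = esymm (Fin n) Kc k := by
    rw [elemSymm, hj, toSc, map_esymm]
  have hRC : ∀ a : ℂ, a ≠ 0 → (RatFunc.C a : Kc) ≠ 0 := fun a ha =>
    (map_ne_zero_iff _ RatFunc.C_injective).mpr ha
  constructor
  · rintro ⟨a, ha, hgreatest, hx⟩
    obtain rfl := eq_unitExp_of_greatest hk1 hkn ha hgreatest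
    obtain ⟨lam, hlam, hlow⟩ := hx.leading _ he
    obtain ⟨d, hd⟩ := hx.homogeneous
    obtain ⟨P, hP, hPx⟩ := (mem_lowerSpan_elemSymm hk1 hkn).mp hlow
    refine ⟨lam, hlam, ?_⟩
    rw [huPow, hesymm] at hPx
    have hxes : x = esHom Kc n (C (RatFunc.C lam) * X j + P) := by
      rw [map_add, map_mul, esHom_C, esHom_X, hj, hPx]
      ring
    -- The degree of `x` is not part of the definition. It is read off from the monomial `e_k`,
    -- which occurs with coefficient `lam ≠ 0` and has weight `k`.
    have hdk : d = k := by
      have hcoeffP : coeff (Finsupp.single j 1) P = 0 := by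
        by_contra hne
        have := mem_lowVars_iff.mp hP _ (mem_support_iff.mpr hne) j (by simp)
        omega
      have hne : coeff (Finsupp.single j 1) (C (RatFunc.C lam) * X j + P) ≠ 0 := by
        rw [coeff_add, hcoeffP, add_zero, coeff_C_mul, coeff_X, if_pos rfl, mul_one]
        exact hRC lam hlam
      rw [hxes] at hd
      rw [← weight_eq_of_isHomogeneous_esHom hd hne, ← weight_unitExp hk1 hkn]
      congr 1
      funext i
      rw [unitExp, Finsupp.single_apply]
      refine if_congr ?_ rfl rfl
      rw [Fin.ext_iff]
      omega
    subst hdk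
    have hdiff : esHom Kc n (P - C (RatFunc.C lam) * Q) = x - C (RatFunc.C lam) * b := by
      rw [map_sub, map_mul, esHom_C, hPx, hb]
      ring
    -- Uniqueness: the difference of `x` and `lam · b` lies in `A`, has degree `k` and is orthogonal
    -- to `A`.
    have hzero : P - C (RatFunc.C lam) * Q = 0 := by
      refine lowVars_nondegenerate hk hkn
        (Subalgebra.sub_mem _ hP (Subalgebra.mul_mem _ (C_mem_lowVars _) hQ)) ?_ fun F hF => ?_
      · rw [hdiff]
        exact hd.sub (hbhom.C_mul _)
      · rw [hdiff, dForm_sub_right, dForm_C_mul_right, h F hF, mul_zero, sub_zero]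
        have hmem := (mem_lowerSpan_elemSymm hk1 hkn).mpr ⟨F, hF, rfl⟩
        generalize esHom Kc n F = f at hmem
        induction hmem using Submodule.span_induction with
        | zero => exact dForm_zero_left _ _
        | add y z _ _ hy hz => rw [dForm_add_left, hy, hz, add_zero]
        | smul c y _ hy => rw [smul_eq_C_mul, dForm_C_mul_left, hy, mul_zero]
        | mem y hy =>
          obtain ⟨a', ha', rfl⟩ := hy
          rw [← dunklForm_eq]
          exact hx.orthogonal _ he a' ha'
    rw [hzero, map_zero] at hdiff
    exact sub_eq_zero.mp hdiff.symm
  · rintro ⟨lam, hlam, rfl⟩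
    refine ⟨unitExp n k, weight_unitExp hk1 hkn, fun a ha hne => invLexLT_of_weight_eq hk1 hkn ha hne,
      ⟨k, hbhom.C_mul _⟩, ?_, fun u hu => ?_, fun u hu a ha => ?_⟩
    · exact (IsSymmetric.C _).mul ((esymm_isSymmetric _ _ _).add (esHom_isSymmetric Q))
    -- For arbitrary generators, `e_k` is `a · u_k` modulo lower generators with `a ∈ ℂ` nonzero, so
    -- the leading coefficient `lam * a` is a complex constant.
    · obtain ⟨a, ha, q, hq, heq⟩ := hu.esymm_eq j
      refine ⟨lam * a, mul_ne_zero hlam ha, ?_⟩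
      rw [hj] at hq
      have h1 : C (RatFunc.C lam) * b - C (RatFunc.C (lam * a)) * uPow u (unitExp n k) =
          RatFunc.C lam • (toSc q + esHom Kc n Q) := by
        rw [huPow, hb, ← hesymm, heq, toSc_add, toSc_mul, toSc_C, smul_eq_C_mul, map_mul, map_mul]
        ring
      rw [h1]
      exact Submodule.smul_mem _ _ (Submodule.add_mem _ (toSc_mem_lowerSpan hk1 hkn hq)
        (lowerSpan_le hk1 hkn hu he ((mem_lowerSpan_elemSymm hk1 hkn).mpr ⟨Q, hQ, rfl⟩)))
    · have hmem : uPow u a ∈ lowerSpan (elemSymm n) (unitExp n k) :=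
        lowerSpan_le hk1 hkn he hu (Submodule.subset_span ⟨a, ha, rfl⟩)
      obtain ⟨F, hF, hFu⟩ := (mem_lowerSpan_elemSymm hk1 hkn).mp hmem
      rw [dunklForm_eq, ← hFu, dForm_C_mul_right, h F hF, mul_zero]

end Canonical

end DunklSn

theorem mainTheorem2 (n k : ℕ) (hk : 2 ≤ k) (hkn : k ≤ n) :
    ∃ e : DunklSn.ScV n,
      (∀ b : DunklSn.ScV n, DunklSn.IsElementaryCanonical n k b ↔
        ∃ lam : ℂ, lam ≠ 0 ∧ b = MvPolynomial.C (RatFunc.C lam) * e) ∧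
      (e - DunklSn.toSc (MvPolynomial.esymm (Fin n) ℂ k) ∈
        DunklSn.lowerSpan (DunklSn.elemSymm n)
          (fun i : Fin n => if (i : ℕ) + 1 = k then 1 else 0)) ∧
      DunklSn.NoPoleAt e ((n : ℂ)⁻¹) ∧
      DunklSn.HasLimitAt e ((n : ℂ)⁻¹) (DunklSn.centeredEsymm n k) := by
  obtain ⟨Q, hQ, hhom, h⟩ := DunklSn.exists_orthogonal hk hkn
  refine ⟨_, DunklSn.isElementaryCanonical_iff hk hkn hQ hhom h,
    (DunklSn.mem_lowerSpan_elemSymm (by omega) hkn).mpr ⟨Q, hQ, ?_⟩,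
    DunklSn.noPoleAt_and_hasLimitAt hk hkn hQ hhom h⟩
  rw [DunklSn.toSc, MvPolynomial.map_esymm, add_sub_cancel_left]
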